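/- Let $\mathfrak g$ be a finite-dimensional complex semisimple Lie algebra with Killing form $\kappa$ and adjoint group $G\subset \mathrm{GL}(\mathfrak g)$ (the group generated by the $\exp(\mathrm{ad}\,x)$, $x\in\mathfrak g$). Put $g=\dim\mathfrak g$, $l=\operatorname{rank}\mathfrak g$, $d=\frac{g+l}{2}$ and $w(x,y,z)=\kappa([x,y],z)$. A linear subspace $W\subset\mathfrak g$ is a nullspace for $(\mathfrak g,w)$ if $w$ vanishes on $W\times W\times W$, and a maximal nullspace if it has maximal dimension among nullspaces. A one-parameter subgroup of a maximal torus $T$ of $G$ is an algebraic homomorphism $\mu:\mathbb C^*\to T$; it is regular if every $\mu$-stable linear subspace of $\mathfrak g$ is $T$-stable. Let $V$ be a maximal nullspace for $(\mathfrak g,w)$. Then: (0) $V$ contains a regular semisimple element of $\mathfrak g$. (a) $V$ contains a Cartan subalgebra of $\mathfrak g$. (b) There exist a maximal torus $T$ of $G$ and a regular one-parameter subgroup $\mu$ of $T$ such that the limit $V_0=\lim_{t\to 0}\mu(t)\cdot V$, taken in the grassmannian of $(\dim V)$-dimensional subspaces of $\mathfrak g$, is a Borel subalgebra of $\mathfrak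 g$. (c) $\dim V=d=\frac{g+l}{2}$. (d) Let $\mathfrak h\subset V$ be any Cartan subalgebra of $\mathfrak g$, $\Phi$ the root system of $(\mathfrak g,\mathfrak h)$, $\mathfrak g_\alpha$ the root space of $\alpha\in\Phi$, and $\Phi^+$ the set of positive roots with respect to any base of $\Phi$. Then there are one-dimensional subspaces $L_\alpha\subset\mathfrak g_\alpha\oplus\mathfrak g_{-\alpha}$ $(\alpha\in\Phi^+)$ such that $$V=\mathfrak h\oplus\bigoplus_{\alpha\in\Phi^+}L_\alpha .$$ -/

import Mathlib

namespace NullSpaces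

open Module Filter Topology

variable {L : Type*} [LieRing L] [LieAlgebra ℂ L]

/-- The invariant alternating trilinear form `w(x, y, z) = κ([x, y], z)`, where `κ` is the
Killing form. -/
noncomputable def w (x y z : L) : ℂ := killingForm ℂ L ⁅x, y⁆ z

/-- A nullspace: a linear subspace `W` such that `w` vanishes on `W × W × W`. -/
def IsNullspace (W : Submodule ℂ L) : Prop :=
  ∀ x ∈ W, ∀ y ∈ W, ∀ z ∈ W, w x y z = 0

/-- A maximal nullspace: a nullspace of maximal dimension. -/
def IsMaximalNullspace (W : Submodule ℂ L) : Prop :=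
  IsNullspace W ∧ ∀ W' : Submodule ℂ L, IsNullspace W' → finrank ℂ W' ≤ finrank ℂ W

/-- A regular semisimple element: `ad s` is a semisimple endomorphism, and the generalized
`0`-eigenspace of `ad s` has the smallest possible dimension, namely the rank. -/
def IsRegularSemisimple [FiniteDimensional ℂ L] (s : L) : Prop :=
  (LieAlgebra.ad ℂ L s).IsSemisimple ∧ LieAlgebra.IsRegular ℂ s

/-- A Borel subalgebra: a maximal solvable subalgebra. -/
def IsBorelSubalgebra (B : LieSubalgebra ℂ L) : Prop :=
  Maximal (fun B' : LieSubalgebra ℂ L ↦ LieAlgebra.IsSolvable B') B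

/-- `e = exp (ad x)`. Convergence of the exponential series is tested on matrix coefficients, which
in finite dimension is convergence for the usual topology of the space of endomorphisms. -/
def IsExpAd (x : L) (e : L ≃ₗ[ℂ] L) : Prop :=
  ∀ (y : L) (f : Dual ℂ L),
    HasSum (fun n : ℕ ↦ (n.factorial : ℂ)⁻¹ * f (((LieAlgebra.ad ℂ L x) ^ n) y)) (f (e y))

variable (L) in
/-- The adjoint group `G`, as the subgroup of `GL(L)` generated by the `exp (ad x)`, `x ∈ L`. -/
def adjointGroup : Subgroup (L ≃ₗ[ℂ] L) :=
  Subgroup.closure {e | ∃ x : L, IsExpAd x e}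

/-- A representation of `(ℂˣ)ⁿ` on `L` is algebraic if its matrix coefficients are Laurent
polynomials in the `n` coordinates. -/
def IsAlgebraicRep {n : ℕ} (φ : (Fin n → ℂˣ) →* (L ≃ₗ[ℂ] L)) : Prop :=
  ∀ (y : L) (f : Dual ℂ L), ∃ (N : ℕ) (p : MvPolynomial (Fin n) ℂ), ∀ t : Fin n → ℂˣ,
    (∏ i, (t i : ℂ)) ^ N * f (φ t y) = MvPolynomial.eval (fun i ↦ (t i : ℂ)) p

/-- An algebraic torus in `GL(L)`: the image of an algebraic homomorphism from some `(ℂˣ)ⁿ`. -/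
def IsTorus (T : Subgroup (L ≃ₗ[ℂ] L)) : Prop :=
  ∃ (n : ℕ) (φ : (Fin n → ℂˣ) →* (L ≃ₗ[ℂ] L)), IsAlgebraicRep φ ∧ φ.range = T

/-- A maximal torus of the adjoint group. -/
def IsMaximalTorus (T : Subgroup (L ≃ₗ[ℂ] L)) : Prop :=
  Maximal (fun T' : Subgroup (L ≃ₗ[ℂ] L) ↦ T' ≤ adjointGroup L ∧ IsTorus T') T

/-- A one-parameter subgroup of `T`: an algebraic homomorphism from `ℂˣ` to `T`, i.e. one
whose matrix coefficients are Laurent polynomials. -/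
def IsOneParameterSubgroup (T : Subgroup (L ≃ₗ[ℂ] L)) (μ : ℂˣ →* (L ≃ₗ[ℂ] L)) : Prop :=
  (∀ t, μ t ∈ T) ∧
  ∀ (y : L) (f : Dual ℂ L), ∃ (N : ℕ) (p : Polynomial ℂ), ∀ t : ℂˣ,
    (t : ℂ) ^ N * f (μ t y) = p.eval (t : ℂ)

/-- A one-parameter subgroup `μ` of `T` is regular if every `μ`-stable subspace is
`T`-stable. -/
def IsRegularOneParameterSubgroup (T : Subgroup (L ≃ₗ[ℂ] L)) (μ : ℂˣ →* (L ≃ₗ[ℂ] L)) : Prop :=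
  IsOneParameterSubgroup T μ ∧
  ∀ W : Submodule ℂ L, (∀ t : ℂˣ, W.map (μ t).toLinearMap ≤ W) →
    ∀ a ∈ T, W.map a.toLinearMap ≤ W

/-- Convergence in the grassmannian: `W i → W₀` along `F` if some bases of the `W i` converge
to a basis of `W₀`. Convergence of vectors is tested on linear forms, which in finite dimension is
convergence for the usual topology. -/
def TendstoGrassmannian {ι : Type*} (F : Filter ι) (W : ι → Submodule ℂ L)
    (W₀ : Submodule ℂ L) : Prop :=
  ∃ (n : ℕ) (v : ι → Fin n → L) (v₀ : Fin n → L),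
    (LinearIndependent ℂ v₀ ∧ Submodule.span ℂ (Set.range v₀) = W₀) ∧
    (∀ᶠ i in F, LinearIndependent ℂ (v i) ∧ Submodule.span ℂ (Set.range (v i)) = W i) ∧
    ∀ (k : Fin n) (f : Dual ℂ L), Tendsto (fun i ↦ f (v i k)) F (𝓝 (f (v₀ k)))

/-- `V₀ = lim_{t → 0} μ(t) · V` in the grassmannian. -/
def IsLimitAtZero (μ : ℂˣ →* (L ≃ₗ[ℂ] L)) (V V₀ : Submodule ℂ L) : Prop :=
  TendstoGrassmannian (comap (fun t : ℂˣ ↦ (t : ℂ)) (𝓝 0))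
    (fun t ↦ V.map (μ t).toLinearMap) V₀

/-- `V` is the internal direct sum of the Cartan subalgebra `H` and of lines
`ℓ α ⊆ L_α ⊕ L_{-α}`, where `α` runs through the roots that are positive for the base `b`. -/
def IsCartanPlusLines [FiniteDimensional ℂ L] [LieAlgebra.IsKilling ℂ L]
    (V : Submodule ℂ L) (H : LieSubalgebra ℂ L) [H.IsCartanSubalgebra]
    (b : (LieAlgebra.IsKilling.rootSystem H).Base) : Prop :=
  ∃ ℓ : {α : H.root // b.IsPos α} → Submodule ℂ L,
    (∀ α, finrank ℂ (ℓ α) = 1 ∧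
      ℓ α ≤ (LieAlgebra.rootSpace H α.1.1).toSubmodule ⊔
        (LieAlgebra.rootSpace H (-α.1.1)).toSubmodule) ∧
    iSupIndep (fun o : Option {α : H.root // b.IsPos α} ↦ o.elim H.toSubmodule ℓ) ∧
    V = H.toSubmodule ⊔ ⨆ α, ℓ α

end NullSpaces

/-! Fix a Cartan subalgebra `H` and an element `l` of `H` on which the weights take pairwise
distinct integral values. The eigenvalues of `ad l` grade `L` with degree-zero part `H`, and the sum
`F i` of the pieces of degree at most `i` gives a filtration for which `F 0` is a nullspace and the
Killing-orthogonal of `F (-1)`. Hence `2 dim (F 0) = dim L + dim H`, and a maximal nullspace has at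
least this dimension. For the converse, move `V` by a Lie automorphism so that its intersections
with the `F i` are as small as possible. Minimality is infinitesimal information: for ad-nilpotent
`e`, a vector of `V ∩ F i` is sent by `ad e` into `V + F i` (`exists_lieEquiv_generic`). If the
moved `V` met `F (-1)`, the leading term of a common vector would be a root vector `a`. With `e` in
the opposite root space, `V` would contain vectors with leading terms `a`, `[e, a]`, `[e, [e, a]]`,
on which `w` is nonzero by an `sl₂` computation (`inf_filtration_eq_bot`). So `V` is a complement of
`F (-1)`, which gives the dimension. Also `l` is an element of `V` plus one of negative degree, and
such a perturbation cannot enlarge the Engel subalgebra, so `V` contains a regular element `s`.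
Since `ad s` maps `V` into its orthogonal, counting dimensions puts the Engel subalgebra of `s`, a
Cartan subalgebra, inside `V`. For any Cartan subalgebra `H` in `V` the same count gives `ad l (V) =
V^⊥`, which contains `ad h (V)` for every `h` in `H`; thus "`ad h / ad l`" preserves `V`. It acts on
both root spaces of `±α` by the scalar `α h / α l`. For suitable `h` these scalars separate the
pairs of opposite roots, so `V` splits along the planes `L_α ⊕ L_{-α}`, and it meets each in a line.
A one-parameter subgroup with distinct exponents on the weights degenerates each such line to a root
space. The limit is again a maximal nullspace, stable under `ad l`; this makes it a subalgebra,
solvable by Cartan's criterion, and maximal among solvable subalgebras because anything larger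
contains an `sl₂`. -/

namespace NullSpaces

open Module Filter Topology

/-! ### Linear algebra: openness of independence, splitting by eigenvalues, dimension counts. -/

section LinearAlgebra

variable {E : Type*} [AddCommGroup E] [Module ℂ E]

/-- If a finite family converges coordinatewise to a linearly independent family, then it is
eventually linearly independent. -/
lemma eventually_linearIndependent {ι J : Type*} [Finite J] {F : Filter ι} {u : ι → J → E}
    {u₀ : J → E} (h₀ : LinearIndependent ℂ u₀)
    (hu : ∀ (j : J) (f : Dual ℂ E), Tendsto (fun i ↦ f (u i j)) F (𝓝 (f (u₀ j)))) :
    ∀ᶠ i in F, LinearIndependent ℂ (u i) := by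
  classical
  have := Fintype.ofFinite J
  obtain ⟨g, hg⟩ := LinearMap.exists_leftInverse_of_injective (Fintype.linearCombination ℂ u₀)
    (LinearMap.ker_eq_bot.mpr h₀.fintypeLinearCombination_injective)
  have hg' (j : J) : g (u₀ j) = Pi.single j 1 := by
    have := LinearMap.congr_fun hg (Pi.single j 1)
    simpa [Fintype.linearCombination_apply_single] using this
  -- Composing with a left inverse of `u₀` turns the families into square matrices tending to the
  -- identity, so independence is detected by a determinant.
  let M : ι → Matrix J J ℂ := fun i ↦ Matrix.of fun a j ↦ g (u i j) a
  have hM : Tendsto M F (𝓝 1) := by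
    refine tendsto_pi_nhds.mpr fun a ↦ tendsto_pi_nhds.mpr fun j ↦ ?_
    have := hu j (LinearMap.proj a ∘ₗ g)
    simpa [M, hg', Matrix.one_apply, Pi.single_apply] using this
  have hdet : Tendsto (fun i ↦ (M i).det) F (𝓝 1) := by
    simpa [Function.comp_def] using
      ((Continuous.matrix_det continuous_id).tendsto (1 : Matrix J J ℂ)).comp hM
  filter_upwards [hdet.eventually_ne one_ne_zero] with i hi
  rw [Fintype.linearIndependent_iff]
  intro c hc
  refine congr_fun (Matrix.eq_zero_of_mulVec_eq_zero hi (v := c) ?_)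
  ext a
  have := congr_fun (congr_arg g hc) a
  simpa [M, Matrix.mulVec, dotProduct, mul_comm] using this

/-- A bilinear form is jointly continuous for coordinatewise convergence. -/
lemma tendsto_bilin [FiniteDimensional ℂ E] {ι : Type*} {F : Filter ι} {a b : ι → E} {a₀ b₀ : E}
    (B : E →ₗ[ℂ] E →ₗ[ℂ] ℂ) (ha : ∀ f : Dual ℂ E, Tendsto (fun i ↦ f (a i)) F (𝓝 (f a₀)))
    (hb : ∀ f : Dual ℂ E, Tendsto (fun i ↦ f (b i)) F (𝓝 (f b₀))) :
    Tendsto (fun i ↦ B (a i) (b i)) F (𝓝 (B a₀ b₀)) := by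
  let e := finBasis ℂ E
  have key (x y : E) : B x y = ∑ j, B x (e j) * e.coord j y := by
    conv_lhs => rw [← e.sum_repr y, map_sum]
    simp [mul_comm]
  rw [key, funext fun i ↦ key (a i) (b i)]
  refine tendsto_finsetSum _ fun j _ ↦ (ha (B.flip (e j))).mul (hb _)

/-- If `∑ yᵢ` lies in a subspace stable under an endomorphism, and the `yᵢ` are eigenvectors for
distinct eigenvalues, then every `yᵢ` lies in it. -/
lemma mem_of_sum_mem_of_eigen {ι : Type*} [Fintype ι] {D : End ℂ E} {W : Submodule ℂ E}
    (hW : ∀ x ∈ W, D x ∈ W) {c : ι → ℂ} (hc : Function.Injective c) {y : ι → E}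
    (hy : ∀ i, D (y i) = c i • y i) (hsum : ∑ i, y i ∈ W) (i : ι) : y i ∈ W := by
  classical
  have hp (p : Polynomial ℂ) (x : E) (hx : x ∈ W) : Polynomial.aeval D p x ∈ W := by
    induction p using Polynomial.induction_on' with
    | add p q hp hq => simpa using W.add_mem hp hq
    | monomial n a =>
      rw [Polynomial.aeval_monomial, Module.End.mul_apply, Module.algebraMap_end_apply]
      refine W.smul_mem _ ?_
      induction n with
      | zero => simpa
      | succ n ih => rw [pow_succ', Module.End.mul_apply]; exact hW _ ih
  -- The Lagrange polynomial at `c i` acts as the projection onto the `i`-th term.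
  have h := hp (Lagrange.basis Finset.univ c i) _ hsum
  rw [map_sum, Finset.sum_eq_single i] at h
  · rwa [Module.End.aeval_apply_of_mem_apply_eq_smul (hy i),
      Lagrange.eval_basis_self hc.injOn (Finset.mem_univ i), one_smul] at h
  · intro j _ hji
    rw [Module.End.aeval_apply_of_mem_apply_eq_smul (hy j),
      Lagrange.eval_basis_of_ne hji.symm (Finset.mem_univ j), zero_smul]
  · simp

/-- Given a direct sum decomposition there is an operator acting on the summands by given
scalars. -/
lemma exists_linearMap_apply_eq_smul {ι : Type*} {U : ι → Submodule ℂ E} (hU : iSupIndep U)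
    (hU' : iSup U = ⊤) (c : ι → ℂ) : ∃ D : End ℂ E, ∀ i, ∀ x ∈ U i, D x = c i • x := by
  classical
  have hI : DirectSum.IsInternal U :=
    (DirectSum.isInternal_submodule_iff_iSupIndep_and_iSup_eq_top U).mpr ⟨hU, hU'⟩
  let B := hI.collectedBasis fun i ↦ Basis.ofVectorSpace ℂ (U i)
  refine ⟨B.constr ℂ fun j ↦ c j.1 • B j, fun i x hx ↦ ?_⟩
  have key : (B.constr ℂ fun j ↦ c j.1 • B j) ∘ₗ (U i).subtype = c i • (U i).subtype := by
    refine (Basis.ofVectorSpace ℂ (U i)).ext fun k ↦ ?_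
    have hB : B ⟨i, k⟩ = Basis.ofVectorSpace ℂ (U i) k := by
      simp [B, DirectSum.IsInternal.collectedBasis_coe]
    have := B.constr_basis ℂ (fun j ↦ c j.1 • B j) ⟨i, k⟩
    rw [hB] at this
    simpa using this
  exact LinearMap.congr_fun key ⟨x, hx⟩

lemma sum_finrank_eq_of_iSupIndep [FiniteDimensional ℂ E] {ι : Type*} [Fintype ι]
    {U : ι → Submodule ℂ E} (hU : iSupIndep U) :
    finrank ℂ (⨆ i, U i : Submodule ℂ E) = ∑ i, finrank ℂ (U i) := by
  classical
  rw [← Module.finrank_directSum ℂ fun i ↦ U i, Submodule.iSup_eq_range_dfinsupp_lsum]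
  exact LinearMap.finrank_range_of_inj hU.dfinsupp_lsum_injective

/-- A lower bound for the rank of a subspace modulo another, in terms of independent vectors. -/
lemma finrank_inf_add_card_le [FiniteDimensional ℂ E] {J : Type*} [Fintype J]
    {V F : Submodule ℂ E} {u : J → E} (hu : ∀ j, u j ∈ V)
    (hli : LinearIndependent ℂ (F.mkQ ∘ u)) :
    finrank ℂ (V ⊓ F : Submodule ℂ E) + Fintype.card J ≤ finrank ℂ V := by
  have h₁ := LinearMap.finrank_range_add_finrank_ker (F.mkQ ∘ₗ V.subtype)
  have h₂ : finrank ℂ (LinearMap.ker (F.mkQ ∘ₗ V.subtype)) =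
      finrank ℂ (V ⊓ F : Submodule ℂ E) := by
    rw [LinearMap.ker_comp, Submodule.ker_mkQ, ← Submodule.map_comap_subtype,
      Submodule.finrank_map_subtype_eq]
  have h₃ : Fintype.card J ≤ finrank ℂ (LinearMap.range (F.mkQ ∘ₗ V.subtype)) := by
    rw [← finrank_span_eq_card hli]
    refine Submodule.finrank_mono (Submodule.span_le.mpr ?_)
    rintro _ ⟨j, rfl⟩
    exact ⟨⟨u j, hu j⟩, rfl⟩
  lia

/-- A lift of a basis of the image of `V` modulo `F`. It turns the dimension of `V ⊓ F` into the
independence of finitely many vectors, which is an open condition. -/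
lemma exists_linearIndependent_mkQ [FiniteDimensional ℂ E] (V F : Submodule ℂ E) :
    ∃ (r : ℕ) (u : Fin r → E), (∀ j, u j ∈ V) ∧ LinearIndependent ℂ (F.mkQ ∘ u) ∧
      finrank ℂ (V ⊓ F : Submodule ℂ E) + r = finrank ℂ V ∧
      Submodule.span ℂ (Set.range (F.mkQ ∘ u)) = V.map F.mkQ := by
  have h₁ := LinearMap.finrank_range_add_finrank_ker (F.mkQ ∘ₗ V.subtype)
  have h₂ : finrank ℂ (LinearMap.ker (F.mkQ ∘ₗ V.subtype)) =
      finrank ℂ (V ⊓ F : Submodule ℂ E) := by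
    rw [LinearMap.ker_comp, Submodule.ker_mkQ, ← Submodule.map_comap_subtype,
      Submodule.finrank_map_subtype_eq]
  have h₃ : LinearMap.range (F.mkQ ∘ₗ V.subtype) = V.map F.mkQ := by
    rw [LinearMap.range_comp, Submodule.range_subtype]
  rw [h₃] at h₁
  let e := finBasis ℂ (V.map F.mkQ)
  choose u hu hue using fun j ↦ (e j).2
  have hcomp : F.mkQ ∘ u = (V.map F.mkQ).subtype ∘ e := funext hue
  refine ⟨_, u, hu, ?_, by lia, ?_⟩
  · rw [hcomp]
    exact e.linearIndependent.map' _ (Submodule.ker_subtype _)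
  · rw [hcomp, Set.range_comp, ← Submodule.map_span, e.span_eq, Submodule.map_top,
      Submodule.range_subtype]

end LinearAlgebra

end NullSpaces

/-! ### General position under exponentials of nilpotent inner derivations. -/

namespace NullSpaces

open Module Filter Topology

variable {L : Type*} [LieRing L] [LieAlgebra ℂ L]

/-- The exponentials of the multiples of a nilpotent inner derivation are automorphisms. -/
lemma exists_lieEquiv_exp {e : L} {N : ℕ} (hN : LieAlgebra.ad ℂ L e ^ N = 0) (c : ℂ) :
    ∃ g : L ≃ₗ⁅ℂ⁆ L, ∀ x, g x = ∑ k ∈ Finset.range N,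
      (c ^ k * (k.factorial : ℂ)⁻¹) • (LieAlgebra.ad ℂ L e ^ k) x := by
  -- The exponential of a nilpotent derivation is defined over `ℚ`, so scalars are restricted along
  -- `ℚ → ℂ`.
  let _ : Module ℚ L := Module.compHom L (algebraMap ℚ ℂ)
  have hq (q : ℚ) (x : L) : q • x = (q : ℂ) • x := rfl
  let _ : LieAlgebra ℚ L := { lie_smul := fun q x y ↦ by simp [hq] }
  have hD : ((LieDerivation.ad ℂ L (c • e)).toLinearMap : End ℂ L) = c • LieAlgebra.ad ℂ L e := by
    ext x
    simp
  have hpow : ((LieDerivation.ad ℂ L (c • e)).toLinearMap : End ℂ L) ^ N = 0 := by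
    rw [hD, smul_pow, hN, smul_zero]
  refine ⟨(LieDerivation.ad ℂ L (c • e)).exp ⟨N, hpow⟩, fun x ↦ ?_⟩
  change IsNilpotent.exp (LieDerivation.ad ℂ L (c • e)).toLinearMap x = _
  rw [IsNilpotent.exp_eq_sum hpow, LinearMap.sum_apply]
  refine Finset.sum_congr rfl fun k _ ↦ ?_
  rw [hD, smul_pow, LinearMap.smul_apply, LinearMap.smul_apply, hq, smul_smul, mul_comm]
  simp

section Semicontinuity

variable {E : Type*} [AddCommGroup E] [Module ℂ E] [FiniteDimensional ℂ E] {D : End ℂ E} {N : ℕ}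
  {G : ℂ → E ≃ₗ[ℂ] E}

/-- Semicontinuity: vectors of `V` independent modulo `F` remain so after a small displacement. -/
lemma eventually_finrank_map_exp_inf_le
    (hG : ∀ c x, G c x = ∑ k ∈ Finset.range N, (c ^ k * (k.factorial : ℂ)⁻¹) • (D ^ k) x)
    (hN : D ^ N = 0) (V F : Submodule ℂ E) :
    ∀ᶠ c in 𝓝 (0 : ℂ), finrank ℂ (V.map (G c).toLinearMap ⊓ F : Submodule ℂ E) ≤
      finrank ℂ (V ⊓ F : Submodule ℂ E) := by
  obtain ⟨r, u, hu, hli, hr, -⟩ := exists_linearIndependent_mkQ V F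
  have hG0 (x : E) : G 0 x = x := by
    rcases N with _ | N
    · have : x = 0 := by simpa using LinearMap.congr_fun hN x
      simp [this]
    · simp [hG, Finset.sum_range_succ']
  have key := eventually_linearIndependent (F := 𝓝 (0 : ℂ))
    (u := fun c j ↦ F.mkQ (G c (u j))) hli fun j f ↦ by
      have : Continuous fun c ↦ f (F.mkQ (G c (u j))) := by
        simp only [hG, map_sum, map_smul, smul_eq_mul]
        fun_prop
      simpa [hG0] using this.tendsto 0
  filter_upwards [key] with c hc
  have h := finrank_inf_add_card_le (V := V.map (G c).toLinearMap) (F := F) (u := fun j ↦ G c (u j))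
    (fun j ↦ ⟨u j, hu j, rfl⟩) hc
  rw [Fintype.card_fin, LinearEquiv.finrank_map_eq] at h
  lia

/-- Modulo `F`, the displaced `x` is `c` times a vector tending to `D x`. As `D x` is not in `V ⊔
F`, it contributes one more independent vector for small nonzero `c`. -/
lemma eventually_finrank_map_exp_inf_lt
    (hG : ∀ c x, G c x = ∑ k ∈ Finset.range N, (c ^ k * (k.factorial : ℂ)⁻¹) • (D ^ k) x)
    (hN : D ^ N = 0) {V F : Submodule ℂ E} {x : E} (hxV : x ∈ V) (hxF : x ∈ F)
    (hx : D x ∉ V ⊔ F) :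
    ∀ᶠ c in 𝓝[≠] (0 : ℂ), finrank ℂ (V.map (G c).toLinearMap ⊓ F : Submodule ℂ E) <
      finrank ℂ (V ⊓ F : Submodule ℂ E) := by
  obtain ⟨r, u, hu, hli, hr, hspan⟩ := exists_linearIndependent_mkQ V F
  obtain ⟨N, rfl⟩ : ∃ M, N = M + 2 := by
    rcases N with _ | _ | N
    · exact absurd (by simpa using LinearMap.congr_fun hN (D x) : D x = 0)
        (fun h ↦ hx (h ▸ zero_mem _))
    · exact absurd (by simpa using LinearMap.congr_fun hN x : D x = 0)
        (fun h ↦ hx (h ▸ zero_mem _))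
    · exact ⟨N, rfl⟩
  have hG0 (y : E) : G 0 y = y := by simp [hG, Finset.sum_range_succ' _ (N + 1)]
  -- The difference quotient `(G c x - x) / c`, continued to `c = 0` by `D x`.
  let z : ℂ → E := fun c ↦ ∑ k ∈ Finset.range (N + 1),
    (c ^ k * ((k + 1).factorial : ℂ)⁻¹) • (D ^ (k + 1)) x
  have hz (c : ℂ) : G c x = x + c • z c := by
    rw [hG, Finset.sum_range_succ', add_comm, Finset.smul_sum]
    congr 1
    · simp
    · refine Finset.sum_congr rfl fun k _ ↦ ?_
      rw [smul_smul]
      congr 1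
      ring
  have hz0 : z 0 = D x := by simp [z, Finset.sum_range_succ' _ N]
  let v : ℂ → Option (Fin r) → E := fun c o ↦ o.elim (z c) fun j ↦ G c (u j)
  have hv0 : LinearIndependent ℂ (F.mkQ ∘ v 0) := by
    rw [linearIndependent_option]
    refine ⟨by simpa [v, hG0, Function.comp_def] using hli, ?_⟩
    have : (F.mkQ ∘ v 0) ∘ some = F.mkQ ∘ u := by ext; simp [v, hG0]
    rw [this, hspan]
    rintro ⟨y, hy, hyx⟩
    simp only [Function.comp_apply, v, Option.elim_none, hz0] at hyx
    rw [← sub_eq_zero, ← map_sub, ← LinearMap.mem_ker, Submodule.ker_mkQ] at hyx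
    have := Submodule.sub_mem _ (Submodule.mem_sup_left (T := F) hy)
      (Submodule.mem_sup_right (S := V) hyx)
    exact hx (by simpa using this)
  have key := eventually_linearIndependent (F := 𝓝 (0 : ℂ))
    (u := fun c j ↦ F.mkQ (v c j)) hv0 fun j f ↦ by
      have : Continuous fun c ↦ f (F.mkQ (v c j)) := by
        rcases j with _ | j
        · simp only [v, z, Option.elim_none, map_sum, map_smul, smul_eq_mul]
          fun_prop
        · simp only [v, Option.elim_some, hG, map_sum, map_smul, smul_eq_mul]
          fun_prop
      exact this.tendsto 0
  filter_upwards [nhdsWithin_le_nhds key, self_mem_nhdsWithin] with c hc hc0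
  let v' : Option (Fin r) → E := fun o ↦ o.elim (G c x) fun j ↦ G c (u j)
  have hv' : LinearIndependent ℂ (F.mkQ ∘ v') := by
    let a : Option (Fin r) → ℂˣ := fun o ↦ o.elim (Units.mk0 c hc0) fun _ ↦ 1
    have hva : F.mkQ ∘ v' = a • fun j ↦ F.mkQ (v c j) := by
      ext o
      rcases o with _ | j
      · have : F.mkQ x = 0 := by simpa using hxF
        simp only [Function.comp_apply, v', Option.elim_none, hz, map_add, map_smul, this, zero_add]
        rfl
      · simp [v', v, a]
    rw [hva]
    exact hc.units_smul a
  have h := finrank_inf_add_card_le (V := V.map (G c).toLinearMap) (F := F) (u := v')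
    (by rintro (_ | j); exacts [⟨x, hxV, rfl⟩, ⟨u j, hu j, rfl⟩]) hv'
  rw [Fintype.card_option, Fintype.card_fin, LinearEquiv.finrank_map_eq] at h
  lia

end Semicontinuity

variable [FiniteDimensional ℂ L]

/-- A subspace can be moved by an automorphism into general position with respect to finitely
many given subspaces. -/
lemma exists_lieEquiv_generic {ι : Type*} [Fintype ι] (V : Submodule ℂ L)
    (F : ι → Submodule ℂ L) :
    ∃ g : L ≃ₗ⁅ℂ⁆ L, ∀ (i : ι) (e : L), IsNilpotent (LieAlgebra.ad ℂ L e) →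
      ∀ x ∈ V.map (g.toLinearEquiv : L →ₗ[ℂ] L), x ∈ F i →
        ⁅e, x⁆ ∈ V.map (g.toLinearEquiv : L →ₗ[ℂ] L) ⊔ F i := by
  let Ψ : (L ≃ₗ⁅ℂ⁆ L) → ℕ := fun g ↦
    ∑ i, finrank ℂ (V.map (g.toLinearEquiv : L →ₗ[ℂ] L) ⊓ F i : Submodule ℂ L)
  -- One automorphism minimizes the sum of all the intersection dimensions. A failure for one `F i`
  -- would lower that term without raising the others.
  let g := Function.argmin Ψ
  refine ⟨g, fun i e he x hx hxF ↦ ?_⟩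
  by_contra hex
  obtain ⟨N, hN⟩ := he
  choose G hG using exists_lieEquiv_exp hN
  have h₁ := eventually_all.mpr fun j ↦ eventually_finrank_map_exp_inf_le
    (G := fun c ↦ (G c).toLinearEquiv) hG hN (V.map (g.toLinearEquiv : L →ₗ[ℂ] L)) (F j)
  have h₂ := eventually_finrank_map_exp_inf_lt
    (G := fun c ↦ (G c).toLinearEquiv) hG hN hx hxF hex
  obtain ⟨c, hc₁, hc₂⟩ := ((h₁.filter_mono nhdsWithin_le_nhds).and h₂).exists
  have hlt : Ψ (g.trans (G c)) < Ψ g := by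
    have hmap : V.map ((g.trans (G c)).toLinearEquiv : L →ₗ[ℂ] L) =
        (V.map (g.toLinearEquiv : L →ₗ[ℂ] L)).map ((G c).toLinearEquiv : L →ₗ[ℂ] L) :=
      Submodule.map_comp _ _ _
    refine Finset.sum_lt_sum (fun j _ ↦ ?_) ⟨i, Finset.mem_univ i, ?_⟩
    · rw [hmap]; exact hc₁ j
    · rw [hmap]; exact hc₂
  exact absurd hlt (Function.not_lt_argmin Ψ _)

end NullSpaces

/-! ### Root spaces and integral coordinates of the weights. -/

namespace NullSpaces

open Module Filter Topology LieAlgebra LieModule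

variable {L : Type*} [LieRing L] [LieAlgebra ℂ L] [FiniteDimensional ℂ L]
  {H : LieSubalgebra ℂ L} [H.IsCartanSubalgebra]

lemma iSup_rootSpace_eq_top :
    ⨆ χ : Weight ℂ H L, (rootSpace H χ).toSubmodule = ⊤ := by
  rw [← LieSubmodule.iSup_toSubmodule, iSup_genWeightSpace_eq_top', LieSubmodule.top_toSubmodule]

lemma iSupIndep_rootSpace {L : Type*} [LieRing L] [LieAlgebra ℂ L]
    {H : LieSubalgebra ℂ L} [H.IsCartanSubalgebra] :
    iSupIndep fun χ : Weight ℂ H L ↦ (rootSpace H χ).toSubmodule :=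
  LieSubmodule.iSupIndep_toSubmodule.mpr (iSupIndep_genWeightSpace' ℂ H L)

lemma exists_eq_sum_rootSpace [Fintype (Weight ℂ H L)] (x : L) :
    ∃ y : Weight ℂ H L → L, (∀ χ : Weight ℂ H L, y χ ∈ rootSpace H χ) ∧ ∑ χ, y χ = x := by
  have hx : x ∈ ⨆ χ ∈ (Finset.univ : Finset (Weight ℂ H L)), (rootSpace H χ).toSubmodule := by
    simp [iSup_rootSpace_eq_top]
  obtain ⟨μ, hμ⟩ := (Submodule.mem_iSup_finset_iff_exists_sum _ _).mp hx
  exact ⟨fun χ ↦ μ χ, fun χ ↦ (μ χ).2, hμ⟩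

lemma mem_rootSpace_of_isZero {χ : Weight ℂ H L} (hχ : χ.IsZero) {x : L} :
    x ∈ rootSpace H χ ↔ x ∈ H := by
  rw [hχ, rootSpace_zero_eq, LieSubalgebra.mem_toLieSubmodule]

lemma linearMap_ext_rootSpace {M : Type*} [AddCommGroup M] [Module ℂ M] {f g : L →ₗ[ℂ] M}
    (h : ∀ χ : Weight ℂ H L, ∀ x ∈ rootSpace H χ, f x = g x) : f = g := by
  ext x
  have hx : x ∈ ⨆ χ : Weight ℂ H L, (rootSpace H χ).toSubmodule :=
    iSup_rootSpace_eq_top (H := H) ▸ Submodule.mem_top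
  induction hx using Submodule.iSup_induction' with
  | mem χ x hx => exact h χ x hx
  | zero => simp
  | add x y _ _ hx hy => rw [map_add, map_add, hx, hy]

variable [IsKilling ℂ L]

lemma coe_reflectionPerm_self (α : H.root) :
    (((IsKilling.rootSystem H).reflectionPerm α α : H.root) : Weight ℂ H L) = -α := by
  have h : (IsKilling.rootSystem H).root ((IsKilling.rootSystem H).reflectionPerm α α) =
      -(IsKilling.rootSystem H).root α := by
    rw [RootPairing.root_reflectionPerm, RootPairing.reflection_apply_self]
  ext x
  exact LinearMap.congr_fun h x

/-- Coordinates of the weights with respect to a base of the root system. -/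
structure WeightCoordinates (H : LieSubalgebra ℂ L) [H.IsCartanSubalgebra] where
  /-- The number of simple roots. -/
  r : ℕ
  /-- The simple roots. -/
  simple : Fin r → Weight ℂ H L
  /-- The simple roots, as a basis of the dual of the Cartan subalgebra. -/
  basis : Basis (Fin r) ℂ (Dual ℂ H)
  basis_apply : ∀ i, basis i = (simple i).toLinear
  /-- The coordinates of a weight. -/
  coeff : Weight ℂ H L → Fin r → ℤ
  toLinear_eq : ∀ χ, χ.toLinear = ∑ i, (coeff χ i : ℂ) • basis i
  induction : ∀ p : Weight ℂ H L → Prop, (∀ i, p (simple i)) → (∀ χ, p χ → p (-χ)) →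
    (∀ (χ ψ : Weight ℂ H L) (i : Fin r), χ.IsNonZero → ψ.IsNonZero →
      (χ : H → ℂ) = ψ + simple i → p ψ → p χ) → ∀ χ, χ.IsNonZero → p χ

lemma nonempty_weightCoordinates (H : LieSubalgebra ℂ L) [H.IsCartanSubalgebra] :
    Nonempty (WeightCoordinates H) := by
  classical
  obtain ⟨b⟩ := (IsKilling.rootSystem H).nonempty_base
  let σ := (Fintype.equivFin b.support).symm
  have hc (χ : Weight ℂ H L) : ∃ m : Fin (Fintype.card b.support) → ℤ,
      χ.toLinear = ∑ i, (m i : ℂ) • (b.toWeightBasis.reindex σ.symm) i := by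
    by_cases hχ : χ.IsZero
    · exact ⟨0, by simpa using Weight.coe_toLinear_eq_zero_iff.mpr hχ⟩
    · classical
      obtain ⟨f, -, -, hf⟩ := b.exists_root_eq_sum_int ⟨χ, by simpa using hχ⟩
      refine ⟨fun i ↦ f (σ i), ?_⟩
      rw [IsKilling.rootSystem_root_apply] at hf
      rw [← Finset.sum_coe_sort] at hf
      simp only [Basis.reindex_apply, Equiv.symm_symm]
      rw [σ.sum_comp (fun j ↦ (f j : ℂ) • b.toWeightBasis j)]
      simpa [Int.cast_smul_eq_zsmul] using hf
  choose m hm using hc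
  refine ⟨⟨_, fun i ↦ (σ i).1.1, b.toWeightBasis.reindex σ.symm, fun i ↦ by simp, m, hm, ?_⟩⟩
  intro p h₁ h₂ h₃ χ hχ
  refine b.induction_add (p := fun α ↦ p α.1) ⟨χ, by simpa using hχ⟩ ?_ ?_ ?_
  · intro α hα
    convert h₂ _ hα using 1
    exact coe_reflectionPerm_self α
  · intro α hα
    simpa using h₁ (σ.symm ⟨α, hα⟩)
  · intro α β γ h hα hβ
    refine h₃ γ.1 α.1 (σ.symm ⟨β, hβ⟩) (H.isNonZero_coe_root γ)
      (H.isNonZero_coe_root α) ?_ hα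
    ext x
    simpa using LinearMap.congr_fun h x

namespace WeightCoordinates

variable (C : WeightCoordinates H)

lemma apply_eq (χ : Weight ℂ H L) (h : H) : χ h = ∑ i, (C.coeff χ i : ℂ) * C.basis i h := by
  simpa using LinearMap.congr_fun (C.toLinear_eq χ) h

lemma coeff_injective : Function.Injective C.coeff := fun χ ψ h ↦ by
  ext x
  rw [C.apply_eq, C.apply_eq, h]

lemma coeff_eq_iff {m : Fin C.r → ℤ} {f : Dual ℂ H} (hf : f = ∑ i, (m i : ℂ) • C.basis i)
    {χ : Weight ℂ H L} (hχ : χ.toLinear = f) : C.coeff χ = m := by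
  rw [C.toLinear_eq, hf, ← sub_eq_zero, ← Finset.sum_sub_distrib] at hχ
  simp only [← sub_smul] at hχ
  ext i
  have := Fintype.linearIndependent_iff.mp C.basis.linearIndependent _ hχ i
  exact_mod_cast sub_eq_zero.mp this

lemma coeff_neg (χ : Weight ℂ H L) : C.coeff (-χ) = -C.coeff χ :=
  C.coeff_eq_iff (f := -χ.toLinear) (by simp [C.toLinear_eq χ]) (by simp)

lemma coeff_of_isZero {χ : Weight ℂ H L} (hχ : χ.IsZero) : C.coeff χ = 0 :=
  C.coeff_eq_iff (f := 0) (by simp) (Weight.coe_toLinear_eq_zero_iff.mpr hχ)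

lemma coeff_add {χ ψ ω : Weight ℂ H L} (h : (χ : H → ℂ) = ψ + ω) :
    C.coeff χ = C.coeff ψ + C.coeff ω :=
  C.coeff_eq_iff (f := ψ.toLinear + ω.toLinear)
    (by simp [C.toLinear_eq ψ, C.toLinear_eq ω, add_smul, Finset.sum_add_distrib])
    (by ext x; simpa using congr_fun h x)

lemma coeff_simple (i : Fin C.r) : C.coeff (C.simple i) = Pi.single i 1 :=
  C.coeff_eq_iff (f := C.basis i) (by simp [Pi.single_apply]) (C.basis_apply i).symm

lemma exists_apply_basis_eq (c : Fin C.r → ℂ) : ∃ h : H, ∀ i, C.basis i h = c i :=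
  ⟨(evalEquiv ℂ H).symm (C.basis.constr ℂ c), fun i ↦ by
    rw [apply_evalEquiv_symm_apply, Basis.constr_basis]⟩

/-- There is a cocharacter separating the weights. -/
lemma exists_degree : ∃ k : Fin C.r → ℤ,
    Function.Injective fun χ : Weight ℂ H L ↦ ∑ i, C.coeff χ i * k i := by
  classical
  have := Fintype.ofFinite (Weight ℂ H L)
  -- An integer vector is encoded as a polynomial. An integer `N` that is no root of the polynomials
  -- of differences of weights separates them all through the exponents `N ^ i`.
  let P (m : Fin C.r → ℤ) : Polynomial ℤ := ∑ i, Polynomial.C (m i) * Polynomial.X ^ (i : ℕ)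
  have hP (m : Fin C.r → ℤ) (hm : P m = 0) : m = 0 := by
    ext i
    have := congr_arg (fun p ↦ Polynomial.coeff p (i : ℕ)) hm
    simpa [P, Polynomial.finsetSum_coeff, Polynomial.coeff_X_pow, Fin.val_inj] using this
  let Q : Polynomial ℤ := ∏ x : {x : Weight ℂ H L × Weight ℂ H L // x.1 ≠ x.2},
    P (C.coeff x.1.1 - C.coeff x.1.2)
  have hQ : Q ≠ 0 := Finset.prod_ne_zero_iff.mpr fun x _ hx ↦
    x.2 (C.coeff_injective (sub_eq_zero.mp (hP _ hx)))
  obtain ⟨N, hN⟩ : ∃ N : ℤ, Q.eval N ≠ 0 := by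
    by_contra! h
    exact hQ (Polynomial.funext fun N ↦ by simpa using h N)
  refine ⟨fun i ↦ N ^ (i : ℕ), fun χ ψ h ↦ ?_⟩
  by_contra hne
  rw [Polynomial.eval_prod, Finset.prod_ne_zero_iff] at hN
  refine hN ⟨(χ, ψ), hne⟩ (Finset.mem_univ _) ?_
  simp only at h
  simp [P, Polynomial.eval_finsetSum, sub_mul, Finset.sum_sub_distrib, h]

end WeightCoordinates

lemma mem_span_of_mem_rootSpace {χ : Weight ℂ H L} (hχ : χ.IsNonZero) {x y : L}
    (hx : x ∈ rootSpace H χ) (hx0 : x ≠ 0) (hy : y ∈ rootSpace H χ) : ∃ c : ℂ, y = c • x := by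
  obtain ⟨c, hc⟩ := (finrank_eq_one_iff_of_nonzero' (⟨x, hx⟩ : rootSpace H χ)
    (by simpa using hx0)).mp (IsKilling.finrank_rootSpace_eq_one χ hχ) ⟨y, hy⟩
  exact ⟨c, by simpa using congr_arg Subtype.val hc.symm⟩

lemma killingForm_ne_zero_of_isSl2Triple {α : Weight ℂ H L} {h e f : L} (t : IsSl2Triple h e f)
    (he : e ∈ rootSpace H α) (hf : f ∈ rootSpace H (-α)) : killingForm ℂ L e f ≠ 0 := fun h0 ↦ by
  have := IsKilling.lie_eq_killingForm_smul_of_mem_rootSpace_of_mem_rootSpace_neg he hf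
  rw [h0, zero_smul, t.lie_e_f] at this
  exact t.h_ne_zero this

/-- The bracket of two root spaces is not zero if the sum of the roots is a root. -/
lemma lie_ne_zero_of_mem_rootSpace {α β γ : Weight ℂ H L} (hα : α.IsNonZero) (hβ : β.IsNonZero)
    (hγ : (γ : H → ℂ) = α + β) {e x : L} (he : e ∈ rootSpace H α) (he0 : e ≠ 0)
    (hx : x ∈ rootSpace H β) (hx0 : x ≠ 0) : ⁅e, x⁆ ≠ 0 := by
  obtain ⟨h, e', f, isSl2, he', hf⟩ := IsKilling.exists_isSl2Triple_of_weight_isNonZero hα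
  obtain rfl := isSl2.h_eq_coroot hα he' hf
  obtain ⟨c, rfl⟩ := mem_span_of_mem_rootSpace hα he' isSl2.e_ne_zero he
  -- Start from the top `z` of the `α`-chain through `β`: `x` is proportional to `f ^ (n + 1) z`,
  -- and `e` sends that vector to `(n + 1) * (chainLength - n)` times `f ^ n z`, which is nonzero.
  obtain ⟨z, hz, hz0⟩ := (chainTop α β).exists_ne_zero
  have prim : isSl2.HasPrimitiveVectorWith z (IsKilling.chainLength α β : ℂ) :=
    have := lie_mem_genWeightSpace_of_mem_genWeightSpace he' hz
    ⟨hz0, (IsKilling.chainLength_smul _ _ hz).symm,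
      by rwa [genWeightSpace_add_chainTop _ _ hα] at this⟩
  have hle := IsKilling.chainTopCoeff_le_chainLength α β
  have hpos : 1 ≤ chainTopCoeff α β := by
    have := ((IsKilling.rootSpace_zsmul_add_ne_bot_iff α β hα 1).mp
      (by rw [one_smul, ← hγ]; exact γ.genWeightSpace_ne_bot)).1
    exact_mod_cast this
  obtain ⟨n, hn⟩ : ∃ n, chainTopCoeff α β = n + 1 := ⟨_, (Nat.sub_add_cancel hpos).symm⟩
  have hmem : (toEnd ℂ L L f ^ (n + 1)) z ∈ rootSpace H β := by
    have := toEnd_pow_apply_mem hf hz (n + 1)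
    rwa [← hn, coe_chainTop', smul_neg, neg_add_cancel_left, hn] at this
  obtain ⟨d, hd⟩ := mem_span_of_mem_rootSpace hβ hx hx0 hmem
  intro h0
  rw [smul_lie, smul_eq_zero] at h0
  have h1 := prim.lie_e_pow_succ_toEnd_f n
  rw [hd, lie_smul, h0.resolve_left (by rintro rfl; simp at he0), smul_zero, eq_comm,
    smul_eq_zero] at h1
  rcases h1 with h1 | h1
  · rw [mul_eq_zero, sub_eq_zero] at h1
    rcases h1 with h1 | h1
    · exact Nat.cast_add_one_ne_zero n h1
    · have : IsKilling.chainLength α β = n := by exact_mod_cast h1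
      lia
  · exact prim.pow_toEnd_f_ne_zero_of_eq_nat rfl (by lia) h1

end NullSpaces

/-! ### The filtration attached to an integral grading. -/

namespace NullSpaces

open Module Filter Topology LieAlgebra LieModule

section Filtration

variable {L : Type*} [LieRing L] [LieAlgebra ℂ L]

/-- The piece of degree `i` of the grading of `L` by the integral eigenvalues of `ad l`. -/
noncomputable def gradedPiece (l : L) (i : ℤ) : Submodule ℂ L := (ad ℂ L l).eigenspace (i : ℂ)

/-- The sum of the graded pieces of degree at most `i`. -/
noncomputable def filtration (l : L) (i : ℤ) : Submodule ℂ L :=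
  ⨆ j : Set.Iic i, gradedPiece l j

variable {l : L}

lemma mem_gradedPiece {i : ℤ} {x : L} : x ∈ gradedPiece l i ↔ ⁅l, x⁆ = (i : ℂ) • x :=
  Module.End.mem_eigenspace_iff

lemma gradedPiece_le_filtration {i j : ℤ} (h : j ≤ i) : gradedPiece l j ≤ filtration l i :=
  le_iSup (fun j : Set.Iic i ↦ gradedPiece l j) ⟨j, h⟩

lemma filtration_mono {i j : ℤ} (h : j ≤ i) : filtration l j ≤ filtration l i :=
  iSup_le fun k ↦ gradedPiece_le_filtration (k.2.trans h)

lemma filtration_eq_sup (i : ℤ) : filtration l i = gradedPiece l i ⊔ filtration l (i - 1) := by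
  refine le_antisymm (iSup_le fun j ↦ ?_)
    (sup_le (gradedPiece_le_filtration le_rfl) (filtration_mono (by lia)))
  rcases eq_or_lt_of_le (show (j : ℤ) ≤ i from j.2) with h | h
  · rw [h]; exact le_sup_left
  · exact (gradedPiece_le_filtration (by lia)).trans le_sup_right

lemma lie_mem_gradedPiece {i j : ℤ} {x y : L} (hx : x ∈ gradedPiece l i)
    (hy : y ∈ gradedPiece l j) : ⁅x, y⁆ ∈ gradedPiece l (i + j) := by
  rw [mem_gradedPiece] at *
  rw [leibniz_lie, hx, hy, smul_lie, lie_smul, ← add_smul, Int.cast_add]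

lemma lie_mem_filtration_of_mem_gradedPiece {i j : ℤ} {x y : L} (hx : x ∈ gradedPiece l i)
    (hy : y ∈ filtration l j) : ⁅x, y⁆ ∈ filtration l (i + j) := by
  induction hy using Submodule.iSup_induction' with
  | mem k y hy =>
    exact gradedPiece_le_filtration (add_le_add_right (show (k : ℤ) ≤ j from k.2) i)
      (lie_mem_gradedPiece hx hy)
  | zero => simp
  | add y z _ _ hy hz => rw [lie_add]; exact add_mem hy hz

lemma lie_mem_filtration {i j : ℤ} {x y : L} (hx : x ∈ filtration l i)
    (hy : y ∈ filtration l j) : ⁅x, y⁆ ∈ filtration l (i + j) := by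
  induction hx using Submodule.iSup_induction' with
  | mem k x hx =>
    exact filtration_mono (add_le_add_left (show (k : ℤ) ≤ i from k.2) j)
      (lie_mem_filtration_of_mem_gradedPiece hx hy)
  | zero => simp
  | add x z _ _ hx hz => rw [add_lie]; exact add_mem hx hz

lemma killingForm_eq_zero_of_mem_gradedPiece {i j : ℤ} {x y : L} (hx : x ∈ gradedPiece l i)
    (hy : y ∈ gradedPiece l j) (hij : i + j ≠ 0) : killingForm ℂ L x y = 0 := by
  rw [mem_gradedPiece] at *
  have h : killingForm ℂ L ⁅l, x⁆ y = -killingForm ℂ L x ⁅l, y⁆ := by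
    rw [← lie_skew, map_neg, LinearMap.neg_apply, traceForm_apply_lie_apply]
  rw [hx, hy, map_smul, map_smul, LinearMap.smul_apply, smul_eq_mul, smul_eq_mul,
    ← add_eq_zero_iff_eq_neg, ← add_mul, mul_eq_zero] at h
  exact h.resolve_left (by exact_mod_cast hij)

lemma killingForm_eq_zero_of_mem_filtration {i j : ℤ} {x y : L} (hx : x ∈ filtration l i)
    (hy : y ∈ filtration l j) (hij : i + j < 0) : killingForm ℂ L x y = 0 := by
  induction hx using Submodule.iSup_induction' with
  | zero => simp
  | add x z _ _ hx hz => simp [hx, hz]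
  | mem k x hx =>
    have hk : (k : ℤ) ≤ i := k.2
    induction hy using Submodule.iSup_induction' with
    | zero => simp
    | add y z _ _ hy hz => simp [hy, hz]
    | mem m y hy =>
      have hm : (m : ℤ) ≤ j := m.2
      exact killingForm_eq_zero_of_mem_gradedPiece hx hy (by lia)

/-- An abelian degree-zero part makes brackets of elements of degree at most `0` fall into degree at
most `-1`, which is orthogonal to degree at most `0`. -/
lemma isNullspace_filtration_zero (hab : ∀ x ∈ gradedPiece l 0, ∀ y ∈ gradedPiece l 0, ⁅x, y⁆ = 0) :
    IsNullspace (filtration l 0) := by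
  intro x hx y hy z hz
  refine killingForm_eq_zero_of_mem_filtration (i := -1) ?_ hz (by lia)
  rw [filtration_eq_sup] at hx hy
  obtain ⟨x₀, hx₀, x₁, hx₁, rfl⟩ := Submodule.mem_sup.mp hx
  obtain ⟨y₀, hy₀, y₁, hy₁, rfl⟩ := Submodule.mem_sup.mp hy
  rw [zero_sub] at hx₁ hy₁
  rw [lie_add, add_lie, add_lie, hab x₀ hx₀ y₀ hy₀, zero_add]
  refine add_mem ?_ (add_mem ?_ ?_)
  · simpa using lie_mem_filtration hx₁ (gradedPiece_le_filtration le_rfl hy₀)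
  · simpa using lie_mem_filtration_of_mem_gradedPiece hx₀ hy₁
  · exact filtration_mono (by lia) (lie_mem_filtration hx₁ hy₁)

lemma exists_filtration_eq_top [FiniteDimensional ℂ L] (hl : ⨆ i, gradedPiece l i = ⊤) :
    ∃ N : ℕ, filtration l N = ⊤ := by
  let F : ℕ →o Submodule ℂ L := ⟨fun N ↦ filtration l N, fun a b h ↦
    filtration_mono (by exact_mod_cast h)⟩
  obtain ⟨N, hN⟩ := monotone_stabilizes_iff_noetherian.mpr (inferInstance : IsNoetherian ℂ L) F
  refine ⟨N, top_le_iff.mp (hl ▸ iSup_le fun i ↦ ?_)⟩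
  have h₁ : gradedPiece l i ≤ filtration l (max N i.toNat : ℕ) :=
    gradedPiece_le_filtration (by push_cast; lia)
  exact h₁.trans (hN _ (le_max_left _ _)).ge

variable [IsKilling ℂ L]

lemma eq_zero_of_forall_killingForm {x : L} (h : ∀ y, killingForm ℂ L x y = 0) : x = 0 :=
  (IsKilling.killingForm_nondegenerate ℂ L).1 x h

lemma filtration_eq_bot {N : ℕ} (hN : filtration l N = ⊤) {i : ℤ} (hi : i < -N) :
    filtration l i = ⊥ :=
  (Submodule.eq_bot_iff _).mpr fun _ hx ↦ eq_zero_of_forall_killingForm fun y ↦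
    killingForm_eq_zero_of_mem_filtration (j := N) hx (hN ▸ Submodule.mem_top) (by lia)

lemma eq_zero_of_forall_gradedPiece
    (hl : ⨆ i, gradedPiece l i = ⊤) {x : L}
    (h : ∀ i, ∀ y ∈ gradedPiece l i, killingForm ℂ L x y = 0) : x = 0 := by
  refine eq_zero_of_forall_killingForm fun y ↦ ?_
  have hy : y ∈ ⨆ i, gradedPiece l i := hl ▸ Submodule.mem_top
  induction hy using Submodule.iSup_induction' with
  | mem i y hy => exact h i y hy
  | zero => simp
  | add y z _ _ hy hz => simp [hy, hz]

lemma eq_zero_of_mem_gradedPiece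
    (hl : ⨆ i, gradedPiece l i = ⊤) {i : ℤ} {x : L} (hx : x ∈ gradedPiece l i)
    (h : ∀ y ∈ gradedPiece l (-i), killingForm ℂ L x y = 0) : x = 0 := by
  refine eq_zero_of_forall_gradedPiece hl fun j y hy ↦ ?_
  by_cases hj : i + j = 0
  · obtain rfl : j = -i := by lia
    exact h y hy
  · exact killingForm_eq_zero_of_mem_gradedPiece hx hy hj

lemma eq_zero_of_mem_gradedPiece_of_mem_filtration
    (hl : ⨆ i, gradedPiece l i = ⊤) {i : ℤ} {x : L} (hx : x ∈ gradedPiece l i)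
    (h : x ∈ filtration l (i - 1)) : x = 0 :=
  eq_zero_of_mem_gradedPiece hl hx fun _ hy ↦
    killingForm_eq_zero_of_mem_filtration h (gradedPiece_le_filtration le_rfl hy) (by lia)

variable [FiniteDimensional ℂ L]

/-- The leading term of a nonzero element. -/
lemma exists_leading_term
    (hl : ⨆ i, gradedPiece l i = ⊤) {x : L} (hx : x ≠ 0) {k : ℤ} (hk : x ∈ filtration l k) :
    ∃ i ≤ k, x ∈ filtration l i ∧
      ∃ y ∈ gradedPiece l i, y ≠ 0 ∧ x - y ∈ filtration l (i - 1) := by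
  obtain ⟨N, hN⟩ := exists_filtration_eq_top hl
  obtain ⟨i, hi, hmin⟩ := Int.exists_least_of_bdd (P := fun i ↦ x ∈ filtration l i)
    ⟨-N, fun i hi ↦ by
      by_contra! h
      rw [filtration_eq_bot hN h] at hi
      exact hx (by simpa using hi)⟩ ⟨k, hk⟩
  refine ⟨i, hmin k hk, hi, ?_⟩
  obtain ⟨y, hy, z, hz, hyz⟩ := Submodule.mem_sup.mp ((filtration_eq_sup (l := l) i).le hi)
  refine ⟨y, hy, ?_, by rw [← hyz]; simpa using hz⟩
  rintro rfl
  have := hmin (i - 1) (by simpa [← hyz] using hz)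
  lia

/-- A leading term of positive degree `i` would be orthogonal to the piece of degree `-i`, the only
piece with which it can pair nontrivially. -/
lemma orthogonal_filtration
    (hl : ⨆ i, gradedPiece l i = ⊤) :
    (killingForm ℂ L).orthogonal (filtration l (-1)) = filtration l 0 := by
  refine le_antisymm (fun x hx ↦ ?_) fun x hx y hy ↦
    killingForm_eq_zero_of_mem_filtration hy hx (by lia)
  by_cases hx0 : x = 0
  · simp [hx0]
  obtain ⟨N, hN⟩ := exists_filtration_eq_top hl
  obtain ⟨i, -, hi, y, hy, hy0, hxy⟩ := exists_leading_term hl hx0 (hN ▸ Submodule.mem_top)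
  by_cases hi0 : i ≤ 0
  · exact filtration_mono hi0 hi
  refine absurd (eq_zero_of_mem_gradedPiece hl hy fun z hz ↦ ?_) hy0
  have h₁ : killingForm ℂ L x z = 0 := by
    rw [traceForm_comm]
    exact hx z (gradedPiece_le_filtration (by lia) hz)
  have h₂ : killingForm ℂ L (x - y) z = 0 :=
    killingForm_eq_zero_of_mem_filtration hxy (gradedPiece_le_filtration le_rfl hz) (by lia)
  rwa [map_sub, LinearMap.sub_apply, h₁, zero_sub, neg_eq_zero] at h₂

lemma finrank_filtration_zero
    (hl : ⨆ i, gradedPiece l i = ⊤) :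
    finrank ℂ (filtration l 0) = finrank ℂ (gradedPiece l 0) + finrank ℂ (filtration l (-1)) := by
  have h := Submodule.finrank_sup_add_finrank_inf_eq (gradedPiece l 0) (filtration l (-1))
  have h' : gradedPiece l 0 ⊓ filtration l (-1) = ⊥ := (Submodule.eq_bot_iff _).mpr
    fun x hx ↦ eq_zero_of_mem_gradedPiece_of_mem_filtration hl hx.1 hx.2
  rw [h', finrank_bot, add_zero] at h
  rw [← h, filtration_eq_sup 0, zero_sub]

lemma finrank_filtration_add
    (hl : ⨆ i, gradedPiece l i = ⊤) : finrank ℂ (filtration l 0) + finrank ℂ (filtration l (-1)) =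
    finrank ℂ L := by
  rw [← orthogonal_filtration hl,
    LinearMap.BilinForm.finrank_orthogonal (IsKilling.killingForm_nondegenerate ℂ L)]
  have := Submodule.finrank_le (filtration l (-1))
  lia

/-- Perturbing `l` by an element of negative degree does not increase the generalized
`0`-eigenspace of `ad l`. -/
lemma finrank_engel_add_le
    (hl : ⨆ i, gradedPiece l i = ⊤) {f : L} (hf : f ∈ filtration l (-1)) :
    finrank ℂ (LieSubalgebra.engel ℂ (l + f)) ≤ finrank ℂ (gradedPiece l 0) := by
  -- Modulo lower degree, `ad (l + f) ^ n` multiplies a leading term of degree `i` by `i ^ n`, so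
  -- the Engel subalgebra has leading terms in degree `0` only.
  have key (x : L) (hx : x ∈ LieSubalgebra.engel ℂ (l + f)) (i : ℤ) (hi : i ≠ 0)
      (y : L) (hy : y ∈ gradedPiece l i) (hxy : x - y ∈ filtration l (i - 1)) : y = 0 := by
    obtain ⟨n, hn⟩ := (LieSubalgebra.mem_engel_iff ℂ (l + f) x).mp hx
    have hpow (n : ℕ) : (ad ℂ L (l + f) ^ n) x - (i : ℂ) ^ n • y ∈ filtration l (i - 1) := by
      induction n with
      | zero => simpa
      | succ n ih =>
        set v := (ad ℂ L (l + f) ^ n) x with hv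
        have h₁ : (ad ℂ L (l + f) ^ (n + 1)) x - (i : ℂ) ^ (n + 1) • y =
            ⁅l, v - (i : ℂ) ^ n • y⁆ + ⁅f, v⁆ := by
          rw [pow_succ', Module.End.mul_apply, ← hv, ad_apply, add_lie, lie_sub, lie_smul,
            mem_gradedPiece.mp hy, smul_smul, pow_succ]
          abel
        have hvi : v ∈ filtration l i := by
          have := add_mem (filtration_mono (show i - 1 ≤ i by lia) ih)
            (gradedPiece_le_filtration le_rfl ((gradedPiece l i).smul_mem ((i : ℂ) ^ n) hy))
          simpa using this
        rw [h₁]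
        refine add_mem ?_ ?_
        · simpa using lie_mem_filtration_of_mem_gradedPiece (i := 0)
            (mem_gradedPiece.mpr (by simp)) ih
        · exact filtration_mono (by lia) (lie_mem_filtration hf hvi)
    have h := hpow n
    rw [hn, zero_sub, neg_mem_iff] at h
    have h' := eq_zero_of_mem_gradedPiece_of_mem_filtration hl (Submodule.smul_mem _ _ hy) h
    exact (smul_eq_zero.mp h').resolve_left (pow_ne_zero _ (by exact_mod_cast hi))
  obtain ⟨N, hN⟩ := exists_filtration_eq_top hl
  have h0 (x : L) (hx : x ∈ LieSubalgebra.engel ℂ (l + f)) (hx0 : x ≠ 0) :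
      x ∈ filtration l 0 ∧ x ∉ filtration l (-1) := by
    constructor
    · obtain ⟨i, -, hi, y, hy, hy0, hxy⟩ := exists_leading_term hl hx0 (k := N)
        (hN ▸ Submodule.mem_top)
      obtain rfl : i = 0 := by
        by_contra h
        exact hy0 (key x hx i h y hy hxy)
      exact hi
    · intro h
      obtain ⟨i, hi', hi, y, hy, hy0, hxy⟩ := exists_leading_term hl hx0 h
      exact hy0 (key x hx i (by lia) y hy hxy)
  set E := (LieSubalgebra.engel ℂ (l + f)).toSubmodule
  have h₁ : E ⊓ filtration l (-1) = ⊥ := (Submodule.eq_bot_iff _).mpr fun x hx ↦ by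
    by_contra hx0
    exact (h0 x hx.1 hx0).2 hx.2
  have h₂ : E ⊔ filtration l (-1) ≤ filtration l 0 := sup_le (fun x hx ↦ by
    by_cases hx0 : x = 0
    · simp [hx0]
    · exact (h0 x hx hx0).1) (filtration_mono (by lia))
  have h₃ := Submodule.finrank_sup_add_finrank_inf_eq E (filtration l (-1))
  have h₄ := Submodule.finrank_mono h₂
  rw [h₁, finrank_bot] at h₃
  have h₅ := finrank_filtration_zero hl
  change finrank ℂ E ≤ _
  lia

/-- A nullspace in general position meets the negative part trivially. -/
lemma inf_filtration_eq_bot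
    (hl : ⨆ i, gradedPiece l i = ⊤) {U : Submodule ℂ L} (hU : IsNullspace U)
    (hgen : ∀ i ≤ 0, ∀ e : L, IsNilpotent (ad ℂ L e) → ∀ x ∈ U, x ∈ filtration l i →
      ⁅e, x⁆ ∈ U ⊔ filtration l i)
    (hsl : ∀ i < 0, ∀ x ∈ gradedPiece l i, x ≠ 0 → ∃ e ∈ gradedPiece l (-i),
      IsNilpotent (ad ℂ L e) ∧ killingForm ℂ L ⁅x, ⁅e, x⁆⁆ ⁅e, ⁅e, x⁆⁆ ≠ 0) :
    U ⊓ filtration l (-1) = ⊥ := by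
  refine (Submodule.eq_bot_iff _).mpr fun x hx ↦ ?_
  by_contra hx0
  obtain ⟨i, hi, hxi, a, ha, ha0, hxa⟩ := exists_leading_term hl hx0 hx.2
  obtain ⟨e, he, hnil, hne⟩ := hsl i (by lia) a ha ha0
  -- General position writes `[e, u]` as an element of `U` plus an error in degree at most `j`.
  -- Since `i ≤ -1`, the error lies below the degree `j - i` of `[e, v]`.
  have lift (j : ℤ) (hj : j ≤ 0) (u v : L) (hu : u ∈ U) (hv : v ∈ gradedPiece l j)
      (huv : u - v ∈ filtration l (j - 1)) :
      ∃ u' ∈ U, u' - ⁅e, v⁆ ∈ filtration l (j - i - 1) := by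
    have huj : u ∈ filtration l j := by
      have := add_mem (filtration_mono (show j - 1 ≤ j by lia) huv)
        (gradedPiece_le_filtration le_rfl hv)
      simpa using this
    obtain ⟨u', hu', z, hz, h⟩ := Submodule.mem_sup.mp (hgen j hj e hnil u hu huj)
    refine ⟨u', hu', ?_⟩
    have h₁ : u' - ⁅e, v⁆ = ⁅e, u - v⁆ - z := by rw [lie_sub, ← h]; abel
    rw [h₁]
    refine sub_mem ?_ (filtration_mono (by lia) hz)
    exact filtration_mono (by lia) (lie_mem_filtration_of_mem_gradedPiece he huv)
  have hb := lie_mem_gradedPiece he ha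
  rw [neg_add_cancel] at hb
  have hc := lie_mem_gradedPiece he hb
  rw [add_zero] at hc
  obtain ⟨y, hyU, hy⟩ := lift i (by lia) x a hx.1 ha hxa
  rw [sub_self, zero_sub] at hy
  obtain ⟨z, hzU, hz⟩ := lift 0 le_rfl y _ hyU hb hy
  rw [zero_sub] at hz
  apply hne
  set b := ⁅e, a⁆
  set c := ⁅e, b⁆
  have hyf : y ∈ filtration l 0 := by
    have := add_mem (filtration_mono (show (-1 : ℤ) ≤ 0 by lia) hy)
      (gradedPiece_le_filtration le_rfl hb)
    simpa using this
  have hzf : z ∈ filtration l (-i) := by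
    have := add_mem (filtration_mono (show -i - 1 ≤ -i by lia) hz)
      (gradedPiece_le_filtration le_rfl hc)
    simpa using this
  have h₁ := hU x hx.1 y hyU z hzU
  -- The leading degrees `i`, `0`, `-i` add up to `0`; replacing a vector by its leading term
  -- changes `w` by a term of total degree at most `-1`, which vanishes.
  have h₂ : killingForm ℂ L ⁅x - a, y⁆ z = 0 := killingForm_eq_zero_of_mem_filtration
    (lie_mem_filtration hxa hyf) hzf (by lia)
  have h₃ : killingForm ℂ L ⁅a, y - b⁆ z = 0 := killingForm_eq_zero_of_mem_filtration
    (lie_mem_filtration_of_mem_gradedPiece ha hy) hzf (by lia)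
  have h₄ : killingForm ℂ L ⁅a, b⁆ (z - c) = 0 := killingForm_eq_zero_of_mem_filtration
    (gradedPiece_le_filtration le_rfl (lie_mem_gradedPiece ha hb)) hz (by lia)
  rw [w] at h₁
  simp only [sub_lie, lie_sub, map_sub, LinearMap.sub_apply] at h₂ h₃ h₄
  linear_combination h₁ - h₂ - h₃ - h₄

end Filtration

end NullSpaces

/-! ### The dimension of a maximal nullspace. -/

namespace NullSpaces

open Module Filter Topology LieAlgebra LieModule

variable {L : Type*} [LieRing L] [LieAlgebra ℂ L]

lemma IsNullspace.map {V : Submodule ℂ L} (hV : IsNullspace V) (g : L ≃ₗ⁅ℂ⁆ L) :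
    IsNullspace (V.map (g.toLinearEquiv : L →ₗ[ℂ] L)) := by
  rintro _ ⟨x, hx, rfl⟩ _ ⟨y, hy, rfl⟩ _ ⟨z, hz, rfl⟩
  have h := hV x hx y hy z hz
  rw [w, ← killingForm_of_equiv_apply g, LieEquiv.map_lie] at h
  exact h

variable [FiniteDimensional ℂ L]

lemma finrank_engel_lieEquiv (g : L ≃ₗ⁅ℂ⁆ L) (x : L) :
    finrank ℂ (LieSubalgebra.engel ℂ (g x)) = finrank ℂ (LieSubalgebra.engel ℂ x) := by
  rw [finrank_engel, finrank_engel, ← conj_ad_apply, LinearEquiv.charpoly_conj]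

variable [IsKilling ℂ L]

/-- A coweight separating the weights of a Cartan subalgebra. -/
structure Coweight (H : LieSubalgebra ℂ L) [H.IsCartanSubalgebra] where
  /-- The underlying element of the Cartan subalgebra. -/
  elt : H
  /-- The value of a weight. -/
  deg : Weight ℂ H L → ℤ
  deg_injective : Function.Injective deg
  apply_eq : ∀ χ : Weight ℂ H L, χ elt = (deg χ : ℂ)

variable {H : LieSubalgebra ℂ L} [H.IsCartanSubalgebra]

lemma nonempty_coweight (H : LieSubalgebra ℂ L) [H.IsCartanSubalgebra] :
    Nonempty (Coweight H) := by
  obtain ⟨C⟩ := nonempty_weightCoordinates H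
  obtain ⟨k, hk⟩ := C.exists_degree
  obtain ⟨l, hl⟩ := C.exists_apply_basis_eq fun i ↦ k i
  exact ⟨⟨l, _, hk, fun χ ↦ by simp [C.apply_eq, hl]⟩⟩

namespace Coweight

variable (l : Coweight H)

lemma deg_neg (χ : Weight ℂ H L) : l.deg (-χ) = -l.deg χ := by
  have := l.apply_eq (-χ)
  rw [Weight.coe_neg, Pi.neg_apply, l.apply_eq] at this
  exact_mod_cast this.symm

/-- The degree is odd and injective, so degree `0` forces `χ = -χ`. -/
lemma deg_eq_zero_iff {χ : Weight ℂ H L} : l.deg χ = 0 ↔ χ.IsZero := by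
  refine ⟨fun h ↦ ?_, fun h ↦ ?_⟩
  · have h' : -χ = χ := l.deg_injective (by rw [deg_neg, h, neg_zero])
    rw [Weight.IsZero]
    ext x
    have := congr_fun (congr_arg (fun ψ : Weight ℂ H L ↦ (ψ : H → ℂ)) h') x
    simp only [Weight.coe_neg, Pi.neg_apply] at this
    exact self_eq_neg.mp this.symm
  · have := l.apply_eq χ
    rw [h, Pi.zero_apply] at this
    exact_mod_cast this.symm

lemma rootSpace_le_gradedPiece (χ : Weight ℂ H L) :
    (rootSpace H χ).toSubmodule ≤ gradedPiece (l.elt : L) (l.deg χ) := fun x hx ↦ by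
  have := IsKilling.lie_eq_smul_of_mem_rootSpace hx l.elt
  rw [l.apply_eq] at this
  exact mem_gradedPiece.mpr this

lemma iSup_gradedPiece : ⨆ i, gradedPiece (l.elt : L) i = ⊤ := by
  rw [eq_top_iff, ← iSup_rootSpace_eq_top (H := H)]
  exact iSup_le fun χ ↦ (l.rootSpace_le_gradedPiece χ).trans (le_iSup _ _)

/-- Distinct weights have distinct degrees, so a nonzero graded piece is a single root space. -/
lemma exists_mem_rootSpace {i : ℤ} {x : L} (hx : x ∈ gradedPiece (l.elt : L) i) (hx0 : x ≠ 0) :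
    ∃ χ : Weight ℂ H L, l.deg χ = i ∧ x ∈ rootSpace H χ := by
  classical
  have := Fintype.ofFinite (Weight ℂ H L)
  obtain ⟨y, hy, rfl⟩ := exists_eq_sum_rootSpace (H := H) x
  have hy' (χ : Weight ℂ H L) := mem_gradedPiece.mp (l.rootSpace_le_gradedPiece χ (hy χ))
  have hW : ∀ x ∈ gradedPiece (l.elt : L) i, ad ℂ L l.elt x ∈ gradedPiece (l.elt : L) i :=
    fun x hx ↦ by
      rw [ad_apply, mem_gradedPiece.mp hx]
      exact Submodule.smul_mem _ _ hx
  have hmem := mem_of_sum_mem_of_eigen hW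
    (c := fun χ ↦ (l.deg χ : ℂ)) (Int.cast_injective.comp l.deg_injective) hy' hx
  have hzero (χ : Weight ℂ H L) (hχ : l.deg χ ≠ i) : y χ = 0 := by
    have h := (hy' χ).symm.trans (mem_gradedPiece.mp (hmem χ))
    rw [← sub_eq_zero, ← sub_smul, smul_eq_zero, sub_eq_zero] at h
    exact h.resolve_left (by exact_mod_cast hχ)
  obtain ⟨χ, -, hχ⟩ := Finset.exists_ne_zero_of_sum_ne_zero hx0
  have hdeg : l.deg χ = i := by
    by_contra h
    exact hχ (hzero χ h)
  refine ⟨χ, hdeg, ?_⟩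
  rw [Finset.sum_eq_single χ (fun ψ _ hψ ↦ hzero ψ fun h ↦ hψ (l.deg_injective (h.trans hdeg.symm)))
    (by simp)]
  exact hy χ

lemma gradedPiece_zero : gradedPiece (l.elt : L) 0 = H.toSubmodule := by
  ext x
  refine ⟨fun hx ↦ ?_, fun hx ↦ ?_⟩
  · by_cases hx0 : x = 0
    · simp [hx0]
    · obtain ⟨χ, hχ, hxχ⟩ := l.exists_mem_rootSpace hx hx0
      exact (mem_rootSpace_of_isZero (l.deg_eq_zero_iff.mp hχ)).mp hxχ
  · rw [mem_gradedPiece, Int.cast_zero, zero_smul]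
    exact congr_arg Subtype.val (trivial_lie_zero H H l.elt ⟨x, hx⟩)

/-- With `x = c f` and the triple `(h, f, e)`, the value is `-4 c ^ 3 κ(f, e)`. -/
lemma exists_killingForm_ne_zero {i : ℤ} (hi : i < 0) {x : L}
    (hx : x ∈ gradedPiece (l.elt : L) i) (hx0 : x ≠ 0) :
    ∃ e ∈ gradedPiece (l.elt : L) (-i), IsNilpotent (ad ℂ L e) ∧
      killingForm ℂ L ⁅x, ⁅e, x⁆⁆ ⁅e, ⁅e, x⁆⁆ ≠ 0 := by
  obtain ⟨χ, rfl, hxχ⟩ := l.exists_mem_rootSpace hx hx0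
  have hχ : χ.IsNonZero := fun h ↦ hi.ne (l.deg_eq_zero_iff.mpr h)
  obtain ⟨h, f, e, t, hf, he⟩ := IsKilling.exists_isSl2Triple_of_weight_isNonZero hχ
  obtain ⟨c, rfl⟩ := mem_span_of_mem_rootSpace hχ hf t.e_ne_zero hxχ
  have hc : c ≠ 0 := by rintro rfl; simp at hx0
  refine ⟨e, ?_, isNilpotent_ad_of_mem_rootSpace H (χ := -χ) (neg_ne_zero.mpr hχ) he, ?_⟩
  · rw [← l.deg_neg]
    exact l.rootSpace_le_gradedPiece (-χ) he
  have hκ := killingForm_ne_zero_of_isSl2Triple t hf he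
  have h₁ : ⁅e, c • f⁆ = -(c • h) := by rw [lie_smul, ← lie_skew, t.lie_e_f, smul_neg]
  have h₂ : ⁅e, -(c • h)⁆ = -((2 * c) • e) := by
    rw [lie_neg, lie_smul, ← lie_skew, t.lie_lie_smul_f ℂ, neg_neg, smul_smul, mul_comm]
  have h₃ : ⁅c • f, -(c • h)⁆ = (2 * c ^ 2) • f := by
    rw [lie_neg, lie_smul, smul_lie, ← lie_skew, t.lie_h_e_smul ℂ, smul_neg, smul_neg, neg_neg,
      smul_smul, smul_smul]
    ring_nf
  rw [h₁, h₂, h₃]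
  simp [hc, hκ]

lemma lie_eq_zero_of_mem {x y : L} (hx : x ∈ H) (hy : y ∈ H) : ⁅x, y⁆ = 0 :=
  congr_arg Subtype.val (trivial_lie_zero H H ⟨x, hx⟩ ⟨y, hy⟩)

end Coweight

/-- The dimension of a maximal nullspace; moreover it contains an element whose Engel subalgebra is
at most as large as a given Cartan subalgebra. -/
lemma IsMaximalNullspace.finrank_eq {V : Submodule ℂ L} (hV : IsMaximalNullspace V)
    (H : LieSubalgebra ℂ L) [H.IsCartanSubalgebra] :
    2 * finrank ℂ V = finrank ℂ L + finrank ℂ H ∧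
      ∃ u ∈ V, finrank ℂ (LieSubalgebra.engel ℂ u) ≤ finrank ℂ H := by
  obtain ⟨l⟩ := nonempty_coweight H
  have hl := l.iSup_gradedPiece
  have hl0 := l.gradedPiece_zero
  obtain ⟨N, hN⟩ := exists_filtration_eq_top hl
  -- Finitely many degrees suffice, because the filtration vanishes below `-N`.
  obtain ⟨g, hg⟩ := exists_lieEquiv_generic V
    fun i : Finset.Icc (-N : ℤ) 0 ↦ filtration (l.elt : L) i
  set U := V.map (g.toLinearEquiv : L →ₗ[ℂ] L) with hUdef
  have hU : U ⊓ filtration (l.elt : L) (-1) = ⊥ := by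
    refine inf_filtration_eq_bot hl (hV.1.map g) (fun i hi e he x hx hxi ↦ ?_)
      fun i hi x hx hx0 ↦ l.exists_killingForm_ne_zero hi hx hx0
    by_cases hiN : i < -N
    · rw [filtration_eq_bot hN hiN, Submodule.mem_bot] at hxi
      simp [hxi]
    · exact hg ⟨i, by simp only [Finset.mem_Icc]; lia⟩ e he x hx hxi
  have hdim : finrank ℂ U = finrank ℂ V := LinearEquiv.finrank_map_eq g.toLinearEquiv V
  have h₁ := finrank_filtration_zero hl
  have h₂ := finrank_filtration_add hl
  have h₃ := hV.2 _ (isNullspace_filtration_zero (l := (l.elt : L)) fun x hx y hy ↦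
    Coweight.lie_eq_zero_of_mem (H := H) (by rwa [hl0] at hx) (by rwa [hl0] at hy))
  have h₄ := Submodule.finrank_sup_add_finrank_inf_eq U (filtration (l.elt : L) (-1))
  have h₅ := Submodule.finrank_le (U ⊔ filtration (l.elt : L) (-1))
  rw [hU, finrank_bot] at h₄
  have h₀ : finrank ℂ (gradedPiece (l.elt : L) 0) = finrank ℂ H := by rw [hl0]; rfl
  refine ⟨by lia, ?_⟩
  -- The dimension bound is attained, so `U` and the negative part span `L`; this expresses `l`
  -- through an element of `U`.
  have htop : U ⊔ filtration (l.elt : L) (-1) = ⊤ :=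
    Submodule.eq_top_of_finrank_eq (by lia)
  obtain ⟨u, hu, f, hf, huf⟩ := Submodule.mem_sup.mp (htop ▸ Submodule.mem_top (x := (l.elt : L)))
  obtain ⟨v, hv, rfl⟩ := hu
  refine ⟨v, hv, ?_⟩
  have hgv : g v = l.elt + -f := by rw [← huf]; simp
  rw [← finrank_engel_lieEquiv g, hgv, ← h₀]
  exact finrank_engel_add_le hl (neg_mem hf)

end NullSpaces

/-! ### Cartan subalgebras contained in a maximal nullspace. -/

namespace NullSpaces

open Module Filter Topology LieAlgebra LieModule

section

variable {L : Type*} [LieRing L] [LieAlgebra ℂ L]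

lemma IsNullspace.map_ad_le {V : Submodule ℂ L} (hV : IsNullspace V) {s : L} (hs : s ∈ V) :
    V.map (ad ℂ L s) ≤ (killingForm ℂ L).orthogonal V := by
  rintro _ ⟨x, hx, rfl⟩ y hy
  change killingForm ℂ L y ⁅s, x⁆ = 0
  rw [traceForm_comm]
  exact hV s hs x hx y hy

variable [FiniteDimensional ℂ L]

/-- Regularity makes this Engel subalgebra of least dimension. Over an infinite field it is then
contained in the Engel subalgebras of all its elements, hence nilpotent by Engel's theorem. -/
lemma isCartanSubalgebra_engel_of_isRegular {x : L} (hx : IsRegular ℂ x) :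
    (LieSubalgebra.engel ℂ x).IsCartanSubalgebra := by
  refine ⟨LieSubalgebra.isNilpotent_of_forall_le_engel _ fun y hy ↦ ?_,
    LieSubalgebra.normalizer_engel _ _⟩
  have hcard : (finrank ℂ L : Cardinal) ≤ Cardinal.mk ℂ :=
    Cardinal.natCast_le_aleph0.trans (Cardinal.infinite_iff.mp inferInstance)
  let E : {LieSubalgebra.engel ℂ z | z ∈ LieSubalgebra.engel ℂ x} :=
    ⟨LieSubalgebra.engel ℂ x, x, LieSubalgebra.self_mem_engel _ _, rfl⟩
  suffices IsBot E from @this ⟨LieSubalgebra.engel ℂ y, y, hy, rfl⟩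
  apply engel_isBot_of_isMin hcard (LieSubalgebra.engel ℂ x) E le_rfl
  rintro ⟨_, y, hy, rfl⟩ hyx
  suffices LieSubalgebra.engel ℂ y = LieSubalgebra.engel ℂ x from this.ge
  apply LieSubalgebra.toSubmodule_injective
  refine Submodule.eq_of_le_of_finrank_le hyx ?_
  change finrank ℂ (LieSubalgebra.engel ℂ x) ≤ finrank ℂ (LieSubalgebra.engel ℂ y)
  rw [(isRegular_iff_finrank_engel_eq_rank ℂ x).mp hx]
  exact rank_le_finrank_engel ℂ y

lemma finrank_map_ad_add (V : Submodule ℂ L) (s : L) :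
    finrank ℂ (V.map (ad ℂ L s)) +
      finrank ℂ (V ⊓ LinearMap.ker (ad ℂ L s) : Submodule ℂ L) = finrank ℂ V := by
  rw [← LinearMap.finrank_range_add_finrank_ker ((ad ℂ L s).domRestrict V),
    LinearMap.range_domRestrict, LinearMap.ker_domRestrict, ← Submodule.map_comap_subtype,
    Submodule.finrank_map_subtype_eq]

end

variable {L : Type*} [LieRing L] [LieAlgebra ℂ L] [FiniteDimensional ℂ L] [IsKilling ℂ L]

lemma finrank_orthogonal_add (V : Submodule ℂ L) :
    finrank ℂ ((killingForm ℂ L).orthogonal V) + finrank ℂ V = finrank ℂ L := by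
  rw [LinearMap.BilinForm.finrank_orthogonal (IsKilling.killingForm_nondegenerate ℂ L)]
  have := Submodule.finrank_le V
  lia

lemma IsMaximalNullspace.two_mul_finrank {V : Submodule ℂ L} (hV : IsMaximalNullspace V) :
    2 * finrank ℂ V = finrank ℂ L + LieAlgebra.rank ℂ L ∧ ∃ s ∈ V, IsRegular ℂ s := by
  obtain ⟨x, hx⟩ := LieAlgebra.exists_isRegular ℂ L
  have := isCartanSubalgebra_engel_of_isRegular hx
  obtain ⟨h₁, u, hu, h₂⟩ := hV.finrank_eq (LieSubalgebra.engel ℂ x)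
  rw [(isRegular_iff_finrank_engel_eq_rank ℂ x).mp hx] at h₁ h₂
  exact ⟨h₁, u, hu, (isRegular_iff_finrank_engel_eq_rank ℂ u).mpr
    (h₂.antisymm (rank_le_finrank_engel ℂ u))⟩

lemma isRegularSemisimple_of_isRegular {s : L} (hs : IsRegular ℂ s) : IsRegularSemisimple s := by
  have := isCartanSubalgebra_engel_of_isRegular hs
  exact ⟨IsKilling.isSemisimple_ad_of_mem_isCartanSubalgebra (LieSubalgebra.self_mem_engel ℂ s), hs⟩

/-- `ad s` maps `V` into `V^⊥`, of dimension `dim V - rank`, so its kernel on `V` has dimension at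
least the rank. That kernel lies in the Engel subalgebra, whose dimension is the rank. -/
lemma IsMaximalNullspace.engel_le {V : Submodule ℂ L} (hV : IsMaximalNullspace V) {s : L}
    (hsV : s ∈ V) (hs : IsRegular ℂ s) : (LieSubalgebra.engel ℂ s).toSubmodule ≤ V := by
  have h₁ := hV.two_mul_finrank.1
  have h₂ := Submodule.finrank_mono (hV.1.map_ad_le hsV)
  have h₃ := finrank_map_ad_add V s
  have h₄ := finrank_orthogonal_add V
  have h₅ : V ⊓ LinearMap.ker (ad ℂ L s) ≤ (LieSubalgebra.engel ℂ s).toSubmodule := fun x hx ↦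
    (LieSubalgebra.mem_engel_iff ℂ s x).mpr ⟨1, by simpa using hx.2⟩
  have h₆ : finrank ℂ (LieSubalgebra.engel ℂ s).toSubmodule = LieAlgebra.rank ℂ L :=
    (isRegular_iff_finrank_engel_eq_rank ℂ s).mp hs
  rw [← Submodule.eq_of_le_of_finrank_le h₅ (by lia)]
  exact inf_le_left

variable {H : LieSubalgebra ℂ L} [H.IsCartanSubalgebra]

/-- The kernel of `ad l` is `H`, so its image on `V` has dimension at least `dim V - dim H = dim
V^⊥`. -/
lemma IsMaximalNullspace.orthogonal_eq {V : Submodule ℂ L} (hV : IsMaximalNullspace V)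
    (hH : H.toSubmodule ≤ V) (l : Coweight H) :
    V.map (ad ℂ L l.elt) = (killingForm ℂ L).orthogonal V := by
  refine Submodule.eq_of_le_of_finrank_le (hV.1.map_ad_le (hH l.elt.2)) ?_
  have h₁ := (hV.finrank_eq H).1
  have h₃ := finrank_map_ad_add V l.elt
  have h₄ := finrank_orthogonal_add V
  have h₅ : V ⊓ LinearMap.ker (ad ℂ L l.elt) ≤ H.toSubmodule := fun x hx ↦ by
    rw [← l.gradedPiece_zero, mem_gradedPiece, Int.cast_zero, zero_smul]
    exact hx.2
  have h₆ := Submodule.finrank_mono h₅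
  have h₇ : finrank ℂ H.toSubmodule = finrank ℂ H := rfl
  lia

/-- A maximal nullspace containing `H` is stable under the operators acting on `L_α` by
`α h / α l`. -/
lemma IsMaximalNullspace.apply_mem {V : Submodule ℂ L} (hV : IsMaximalNullspace V)
    (hH : H.toSubmodule ≤ V) (l : Coweight H) (h : H) {D : End ℂ L}
    (hD : ∀ χ : Weight ℂ H L, ∀ x ∈ rootSpace H χ, D x = (χ h / χ l.elt) • x) {v : L}
    (hv : v ∈ V) : D v ∈ V := by
  -- `D` is a quotient of `ad h` by `ad l`. On the zero weight, the only one vanishing at `l`, the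
  -- convention `0 / 0 = 0` makes it zero.
  have hcomp : ad ℂ L l.elt ∘ₗ D = ad ℂ L h := linearMap_ext_rootSpace (H := H) fun χ x hx ↦ by
    have h₁ : ⁅(l.elt : L), x⁆ = χ l.elt • x := IsKilling.lie_eq_smul_of_mem_rootSpace hx l.elt
    have h₂ : ⁅(h : L), x⁆ = χ h • x := IsKilling.lie_eq_smul_of_mem_rootSpace hx h
    rw [LinearMap.comp_apply, hD χ x hx, ad_apply, ad_apply, lie_smul, h₁, h₂, smul_smul]
    by_cases hχ : χ l.elt = 0
    · have : χ.IsZero := l.deg_eq_zero_iff.mp (by rw [l.apply_eq] at hχ; exact_mod_cast hχ)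
      simp [this.eq]
    · rw [div_mul_cancel₀ _ hχ]
  have hmem : ⁅(h : L), v⁆ ∈ V.map (ad ℂ L l.elt) := by
    rw [hV.orthogonal_eq hH l]
    exact hV.1.map_ad_le (hH h.2) ⟨v, hv, rfl⟩
  obtain ⟨v', hv', h'⟩ := hmem
  -- `D v` and `v'` have the same image under `ad l`, so they differ by an element of `H`, which
  -- lies in `V`.
  have h₁ : D v - v' ∈ H.toSubmodule := by
    rw [← l.gradedPiece_zero, mem_gradedPiece, Int.cast_zero, zero_smul, lie_sub, sub_eq_zero]
    exact (LinearMap.congr_fun hcomp v).trans h'.symm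
  simpa using add_mem (hH h₁) hv'

/-- There is an element of `H` separating the pairs of opposite roots. -/
lemma exists_div_injective (l : Coweight H) : ∃ h : H,
    (∀ α : Weight ℂ H L, α.IsNonZero → α h / α l.elt ≠ 0) ∧
    ∀ α β : Weight ℂ H L, α.IsNonZero → β.IsNonZero → α h / α l.elt = β h / β l.elt →
      α = β ∨ α = -β := by
  let I := {p : Weight ℂ H L × Weight ℂ H L //
    p.1.IsNonZero ∧ p.2.IsNonZero ∧ ¬ (p.1 = p.2 ∨ p.1 = -p.2)}
  let J := {α : Weight ℂ H L // α.IsNonZero}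
  have hne {α : Weight ℂ H L} (hα : α.IsNonZero) : α l.elt ≠ 0 := by
    rw [l.apply_eq]
    exact_mod_cast fun h ↦ hα (l.deg_eq_zero_iff.mp h)
  -- Finitely many nonzero linear forms have a common point of nonvanishing. The forms `β(l) α -
  -- α(l) β` are nonzero because proportional roots are equal or opposite.
  obtain ⟨h, hh⟩ := Module.Dual.exists_forall_ne_zero_of_forall_exists (K := ℂ) (M := H)
    (ι := I ⊕ J) (Sum.elim
      (fun p ↦ p.1.2 l.elt • p.1.1.toLinear - p.1.1 l.elt • p.1.2.toLinear)
      fun α ↦ α.1.toLinear) (by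
        rintro (⟨⟨α, β⟩, hα, hβ, hαβ⟩ | ⟨α, hα⟩)
        · by_contra! h0
          refine hαβ (Or.symm (IsKilling.eq_neg_or_eq_of_eq_smul β α hα (α l.elt / β l.elt) ?_))
          ext x
          have := h0 x
          simp only [Sum.elim_inl, LinearMap.sub_apply, LinearMap.smul_apply, smul_eq_mul,
            Weight.toLinear_apply] at this
          have h' := hne hβ
          simp only [Pi.smul_apply, smul_eq_mul]
          field_simp
          linear_combination this
        · exact ⟨l.elt, by simpa using hne hα⟩)
  refine ⟨h, fun α hα ↦ div_ne_zero (by simpa using hh (Sum.inr ⟨α, hα⟩)) (hne hα),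
    fun α β hα hβ h' ↦ ?_⟩
  by_contra hαβ
  apply hh (Sum.inl ⟨(α, β), hα, hβ, hαβ⟩)
  rw [div_eq_div_iff (hne hα) (hne hβ)] at h'
  simp only [Sum.elim_inl, LinearMap.sub_apply, LinearMap.smul_apply, smul_eq_mul,
    Weight.toLinear_apply]
  linear_combination h'

end NullSpaces

/-! ### Splitting a maximal nullspace into lines in the planes of opposite roots. -/

namespace NullSpaces

open Module Filter Topology LieAlgebra LieModule

variable {L : Type*} [LieRing L] [LieAlgebra ℂ L] [FiniteDimensional ℂ L] [IsKilling ℂ L]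
  {H : LieSubalgebra ℂ L} [H.IsCartanSubalgebra]

/-- The positive roots with respect to a base. -/
abbrev PosRoot (b : (IsKilling.rootSystem H).Base) : Type _ := {α : H.root // b.IsPos α}

section PosRoot

variable (b : (IsKilling.rootSystem H).Base)

lemma exists_posRoot {χ : Weight ℂ H L} (hχ : χ.IsNonZero) :
    ∃ α : PosRoot b, χ = α.1.1 ∨ χ = -α.1.1 := by
  let α : H.root := ⟨χ, by simpa using hχ⟩
  rcases RootPairing.Base.IsPos.or_neg b α with h | h
  · exact ⟨⟨α, h⟩, Or.inl rfl⟩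
  · refine ⟨⟨_, h⟩, Or.inr ?_⟩
    change χ = -(((IsKilling.rootSystem H).reflectionPerm α α : H.root) : Weight ℂ H L)
    rw [coe_reflectionPerm_self, neg_neg]

lemma PosRoot.ne_neg (α β : PosRoot b) : α.1.1 ≠ -β.1.1 := fun h ↦ by
  have h' : α.1 = (IsKilling.rootSystem H).reflectionPerm β.1 β.1 :=
    Subtype.ext (h.trans (coe_reflectionPerm_self _).symm)
  have hα := α.2
  rw [h'] at hα
  exact (RootPairing.Base.IsPos.neg_iff_not b β.1).mp hα β.2

lemma PosRoot.isNonZero (α : PosRoot b) : α.1.1.IsNonZero := H.isNonZero_coe_root α.1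

/-- The Cartan subalgebra and the planes spanned by opposite root spaces. -/
noncomputable def rootPlane (o : Option (PosRoot b)) : Submodule ℂ L :=
  o.elim H.toSubmodule fun α ↦
    (rootSpace H α.1.1).toSubmodule ⊔ (rootSpace H (-α.1.1)).toSubmodule

lemma rootSpace_le_rootPlane (χ : Weight ℂ H L) :
    ∃ o, (rootSpace H χ).toSubmodule ≤ rootPlane b o := by
  by_cases hχ : χ.IsZero
  · exact ⟨none, fun x hx ↦ (mem_rootSpace_of_isZero hχ).mp hx⟩
  · obtain ⟨α, rfl | rfl⟩ := exists_posRoot b hχ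
    · exact ⟨some α, le_sup_left⟩
    · exact ⟨some α, le_sup_right⟩

lemma iSup_rootPlane : ⨆ o, rootPlane b o = ⊤ := by
  rw [eq_top_iff, ← iSup_rootSpace_eq_top (H := H)]
  refine iSup_le fun χ ↦ ?_
  obtain ⟨o, ho⟩ := rootSpace_le_rootPlane b χ
  exact ho.trans (le_iSup _ o)

lemma exists_eq_sum_rootPlane [Fintype (PosRoot b)] (x : L) :
    ∃ y : Option (PosRoot b) → L, (∀ o, y o ∈ rootPlane b o) ∧ ∑ o, y o = x := by
  have hx : x ∈ ⨆ o ∈ (Finset.univ : Finset (Option (PosRoot b))), rootPlane b o := by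
    simp [iSup_rootPlane]
  obtain ⟨μ, hμ⟩ := (Submodule.mem_iSup_finset_iff_exists_sum _ _).mp hx
  exact ⟨fun o ↦ μ o, fun o ↦ (μ o).2, hμ⟩

/-- An operator which is scalar, with different scalars, on the Cartan subalgebra and the planes
spanned by opposite root spaces, and which stabilizes every maximal nullspace containing `H`. -/
lemma exists_separating_operator : ∃ (D : End ℂ L) (c : Option (PosRoot b) → ℂ),
    Function.Injective c ∧ (∀ o, ∀ x ∈ rootPlane b o, D x = c o • x) ∧
    ∀ V : Submodule ℂ L, IsMaximalNullspace V → H.toSubmodule ≤ V → ∀ v ∈ V, D v ∈ V := by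
  obtain ⟨l⟩ := nonempty_coweight H
  obtain ⟨h, hh₁, hh₂⟩ := exists_div_injective l
  obtain ⟨D, hD⟩ := exists_linearMap_apply_eq_smul (iSupIndep_rootSpace (H := H))
    iSup_rootSpace_eq_top fun χ ↦ χ h / χ l.elt
  refine ⟨D, fun o ↦ o.elim 0 fun α ↦ α.1.1 h / α.1.1 l.elt, ?_, ?_,
    fun V hV hH v hv ↦ hV.apply_mem hH l h hD hv⟩
  · rintro (_ | α) (_ | β) hαβ
    · rfl
    · exact absurd hαβ.symm (hh₁ _ (PosRoot.isNonZero b β))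
    · exact absurd hαβ (hh₁ _ (PosRoot.isNonZero b α))
    · rcases hh₂ _ _ (PosRoot.isNonZero b α) (PosRoot.isNonZero b β) hαβ with h | h
      · rw [Subtype.ext (Subtype.ext h)]
      · exact absurd h (PosRoot.ne_neg b α β)
  · rintro (_ | α) x hx
    · rcases eq_or_ne x 0 with rfl | hx0
      · simp
      obtain ⟨χ, hχ, hxχ⟩ := l.exists_mem_rootSpace (l.gradedPiece_zero.ge hx) hx0
      rw [hD χ x hxχ, (l.deg_eq_zero_iff.mp hχ).eq]
      simp
    · obtain ⟨y, hy, z, hz, rfl⟩ := Submodule.mem_sup.mp hx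
      rw [map_add, hD α.1.1 y hy, hD (-α.1.1) z hz, smul_add]
      simp

lemma iSupIndep_rootPlane : iSupIndep (rootPlane b) := by
  obtain ⟨D, c, hc, hD, -⟩ := exists_separating_operator b
  exact (D.eigenspaces_iSupIndep.comp hc).mono fun o x hx ↦
    Module.End.mem_eigenspace_iff.mpr (hD o x hx)

lemma finrank_rootPlane_some (α : PosRoot b) : finrank ℂ (rootPlane b (some α)) = 2 := by
  have h := Submodule.finrank_sup_add_finrank_inf_eq (rootSpace H α.1.1).toSubmodule
    (rootSpace H (-α.1.1)).toSubmodule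
  have hd := iSupIndep_rootSpace.pairwiseDisjoint (PosRoot.ne_neg b α α)
  have h₁ : finrank ℂ (rootSpace H α.1.1).toSubmodule = 1 :=
    IsKilling.finrank_rootSpace_eq_one _ (PosRoot.isNonZero b α)
  have h₂ : finrank ℂ (rootSpace H (-α.1.1)).toSubmodule = 1 :=
    IsKilling.finrank_rootSpace_eq_one (-α.1.1) (PosRoot.isNonZero b α).neg
  have h₃ : (rootSpace H α.1.1).toSubmodule ⊓ (rootSpace H (-α.1.1)).toSubmodule = ⊥ := hd.eq_bot
  rw [h₁, h₂, h₃, finrank_bot] at h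
  exact h

variable {b} {V : Submodule ℂ L}

/-- Otherwise `V` contains a whole triple `h, e, f`, and `w h e f = 2 κ(e, f)` is not zero. -/
lemma IsNullspace.finrank_inf_rootPlane_le (hV : IsNullspace V) (hH : H.toSubmodule ≤ V)
    (α : PosRoot b) : finrank ℂ (V ⊓ rootPlane b (some α) : Submodule ℂ L) ≤ 1 := by
  by_contra! h
  have hle : rootPlane b (some α) ≤ V := by
    rw [← Submodule.eq_of_le_of_finrank_le (inf_le_right : V ⊓ rootPlane b (some α) ≤ _)
      (by rw [finrank_rootPlane_some]; exact h)]
    exact inf_le_left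
  obtain ⟨h, e, f, t, he, hf⟩ :=
    IsKilling.exists_isSl2Triple_of_weight_isNonZero (PosRoot.isNonZero b α)
  have hhH : h ∈ V := by
    rw [t.h_eq_coroot (PosRoot.isNonZero b α) he hf]
    exact hH (Subtype.property _)
  have h0 := hV h hhH e (hle (Submodule.mem_sup_left he)) f (hle (Submodule.mem_sup_right hf))
  rw [w, t.lie_h_e_smul ℂ, map_smul, LinearMap.smul_apply, smul_eq_mul, mul_eq_zero] at h0
  exact h0.elim two_ne_zero (killingForm_ne_zero_of_isSl2Triple t he hf)

lemma IsMaximalNullspace.eq_iSup_inf_rootPlane (hV : IsMaximalNullspace V)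
    (hH : H.toSubmodule ≤ V) : V = ⨆ o, V ⊓ rootPlane b o := by
  classical
  have := Fintype.ofFinite (PosRoot b)
  obtain ⟨D, c, hc, hD, hDV⟩ := exists_separating_operator b
  refine le_antisymm (fun x hx ↦ ?_) (iSup_le fun o ↦ inf_le_left)
  obtain ⟨y, hy, rfl⟩ := exists_eq_sum_rootPlane b x
  have := mem_of_sum_mem_of_eigen (hDV V hV hH) hc (fun o ↦ hD o _ (hy o)) hx
  exact sum_mem fun o _ ↦ Submodule.mem_iSup_of_mem o ⟨this o, hy o⟩

lemma IsMaximalNullspace.finrank_inf_rootPlane (hV : IsMaximalNullspace V)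
    (hH : H.toSubmodule ≤ V) (α : PosRoot b) :
    finrank ℂ (V ⊓ rootPlane b (some α) : Submodule ℂ L) = 1 := by
  classical
  have := Fintype.ofFinite (PosRoot b)
  have h₁ := (hV.finrank_eq H).1
  have h₂ := sum_finrank_eq_of_iSupIndep (iSupIndep_rootPlane b)
  have h₃ := sum_finrank_eq_of_iSupIndep
    ((iSupIndep_rootPlane b).mono fun o ↦ (inf_le_right : V ⊓ rootPlane b o ≤ _))
  rw [← hV.eq_iSup_inf_rootPlane hH, Fintype.sum_option] at h₃
  rw [iSup_rootPlane, finrank_top, Fintype.sum_option] at h₂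
  have h₄ : V ⊓ rootPlane b none = H.toSubmodule := inf_eq_right.mpr hH
  have h₅ : finrank ℂ (rootPlane b none) = finrank ℂ H := rfl
  have h₆ : finrank ℂ H.toSubmodule = finrank ℂ H := rfl
  rw [h₄, h₆] at h₃
  simp only [finrank_rootPlane_some] at h₂
  -- From `2 dim V = dim L + dim H` and `dim L = dim H + 2 |Φ⁺|`, the intersections have total
  -- dimension `|Φ⁺|`. As each is at most `1`, all are equal to `1`.
  have hsum : ∑ β : PosRoot b, finrank ℂ (V ⊓ rootPlane b (some β) : Submodule ℂ L) =
      ∑ β : PosRoot b, 1 := by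
    simp only [Finset.sum_const] at h₂ ⊢
    simp only [smul_eq_mul] at h₂ ⊢
    lia
  exact (Finset.sum_eq_sum_iff_of_le
    fun β _ ↦ hV.1.finrank_inf_rootPlane_le hH β).mp hsum α (Finset.mem_univ α)

theorem IsMaximalNullspace.isCartanPlusLines (hV : IsMaximalNullspace V)
    (hH : H.toSubmodule ≤ V) : IsCartanPlusLines V H b := by
  have hnone : V ⊓ rootPlane b none = H.toSubmodule := inf_eq_right.mpr hH
  refine ⟨fun α ↦ V ⊓ rootPlane b (some α), fun α ↦
    ⟨hV.finrank_inf_rootPlane hH α, inf_le_right⟩, (iSupIndep_rootPlane b).mono ?_, ?_⟩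
  · rintro (_ | α)
    exacts [le_rfl, inf_le_right]
  · conv_lhs => rw [hV.eq_iSup_inf_rootPlane (b := b) hH, iSup_option, hnone]

end PosRoot

end NullSpaces

/-! ### The adjoint group acts by Lie algebra automorphisms. -/

namespace NullSpaces

open Module Filter Topology LieAlgebra LieModule

section ExpAd

variable {L : Type*} [LieRing L] [LieAlgebra ℂ L]

/-- The Leibniz rule for the divided powers of a derivation. -/
lemma ad_pow_lie (x y z : L) (n : ℕ) :
    (n.factorial : ℂ)⁻¹ • (ad ℂ L x ^ n) ⁅y, z⁆ = ∑ p ∈ Finset.HasAntidiagonal.antidiagonal n,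
      ⁅(p.1.factorial : ℂ)⁻¹ • (ad ℂ L x ^ p.1) y, (p.2.factorial : ℂ)⁻¹ • (ad ℂ L x ^ p.2) z⁆ := by
  rw [LieAlgebra.ad_pow_lie, Finset.smul_sum]
  refine Finset.sum_congr rfl fun p hp ↦ ?_
  rw [← Finset.HasAntidiagonal.mem_antidiagonal.mp hp, ← Nat.cast_smul_eq_nsmul ℂ, smul_lie,
    lie_smul, smul_smul, smul_smul]
  have h : ((p.1 + p.2).choose p.1 : ℂ) * p.1.factorial * p.2.factorial =
      (p.1 + p.2).factorial := by
    rw [Nat.choose_symm_add]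
    exact_mod_cast Nat.add_choose_mul_factorial_mul_factorial p.1 p.2
  congr 1
  have h₁ := Nat.factorial_ne_zero p.1
  have h₂ := Nat.factorial_ne_zero p.2
  have h₃ := Nat.factorial_ne_zero (p.1 + p.2)
  field_simp
  exact h

variable [FiniteDimensional ℂ L]

/-- In coordinates both sides are sums of scalar series: the Leibniz rule makes the series of the
bracket the Cauchy product of the two absolutely convergent exponential series. -/
lemma IsExpAd.map_lie {x : L} {e : L ≃ₗ[ℂ] L} (he : IsExpAd x e) (y z : L) :
    e ⁅y, z⁆ = ⁅e y, e z⁆ := by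
  let B := finBasis ℂ L
  rw [← sub_eq_zero, ← forall_dual_apply_eq_zero_iff ℂ]
  intro f
  rw [map_sub, sub_eq_zero]
  have hexp (a b : L) : f ⁅a, b⁆ = ∑ i, ∑ j, f ⁅B i, B j⁆ * (B.coord i a * B.coord j b) := by
    conv_lhs => rw [← B.sum_repr a, ← B.sum_repr b]
    simp only [sum_lie, lie_sum, map_sum, lie_smul, smul_lie, map_smul, smul_eq_mul,
      Finset.mul_sum]
    rw [Finset.sum_comm]
    refine Finset.sum_congr rfl fun i _ ↦ Finset.sum_congr rfl fun j _ ↦ ?_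
    simp only [Basis.coord_apply]
    ring
  let u (i) (v : L) (n : ℕ) : ℂ := B.coord i ((n.factorial : ℂ)⁻¹ • (ad ℂ L x ^ n) v)
  have hu (i) (v : L) : HasSum (u i v) (B.coord i (e v)) := by
    simpa [u] using he v (B.coord i)
  have hprod (i j) : HasSum
      (fun n ↦ ∑ p ∈ Finset.HasAntidiagonal.antidiagonal n, u i y p.1 * u j z p.2)
      (B.coord i (e y) * B.coord j (e z)) := by
    have h₁ := (hu i y).summable.norm
    have h₂ := (hu j z).summable.norm
    have h₃ := (summable_norm_sum_mul_antidiagonal_of_summable_norm h₁ h₂).of_norm.hasSum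
    rwa [← tsum_mul_tsum_eq_tsum_sum_antidiagonal_of_summable_norm h₁ h₂, (hu i y).tsum_eq,
      (hu j z).tsum_eq] at h₃
  have hsum := hasSum_sum (s := Finset.univ) fun i _ ↦ hasSum_sum (s := Finset.univ) fun j _ ↦
    (hprod i j).mul_left (f ⁅B i, B j⁆)
  rw [← hexp] at hsum
  refine (he ⁅y, z⁆ f).unique (hsum.congr_fun fun n ↦ ?_)
  rw [← smul_eq_mul, ← map_smul, ad_pow_lie, map_sum]
  rw [Finset.sum_congr rfl fun p _ ↦ hexp _ _, Finset.sum_comm]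
  refine Finset.sum_congr rfl fun i _ ↦ ?_
  rw [Finset.sum_comm]
  exact Finset.sum_congr rfl fun j _ ↦ (Finset.mul_sum _ _ _).symm

lemma map_lie_of_mem_adjointGroup {a : L ≃ₗ[ℂ] L} (ha : a ∈ adjointGroup L) (y z : L) :
    a ⁅y, z⁆ = ⁅a y, a z⁆ := by
  induction ha using Subgroup.closure_induction generalizing y z with
  | mem a ha =>
    obtain ⟨x, hx⟩ := ha
    exact hx.map_lie y z
  | one => rfl
  | mul a b _ _ iha ihb => rw [LinearEquiv.mul_apply, ihb, iha]; rfl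
  | inv a _ ih =>
    apply a.injective
    rw [ih]
    change a (a.symm _) = ⁅a (a.symm _), a (a.symm _)⁆
    simp

end ExpAd

end NullSpaces

/-! ### The torus of a Cartan subalgebra and its one-parameter subgroups. -/

namespace NullSpaces

open Module Filter Topology LieAlgebra LieModule

section Diagonal

variable {L : Type*} [LieRing L] [LieAlgebra ℂ L] [FiniteDimensional ℂ L]
  {H : LieSubalgebra ℂ L} [H.IsCartanSubalgebra]

/-- The operator acting on the root spaces by given scalars. -/
noncomputable def diagonal (c : Weight ℂ H L → ℂ) : End ℂ L :=
  (exists_linearMap_apply_eq_smul (iSupIndep_rootSpace (H := H)) iSup_rootSpace_eq_top c).choose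

lemma diagonal_apply (c : Weight ℂ H L → ℂ) {χ : Weight ℂ H L} {x : L} (hx : x ∈ rootSpace H χ) :
    diagonal c x = c χ • x :=
  (exists_linearMap_apply_eq_smul (iSupIndep_rootSpace (H := H))
    iSup_rootSpace_eq_top c).choose_spec χ x hx

lemma diagonal_comp (c d : Weight ℂ H L → ℂ) : diagonal c ∘ₗ diagonal d = diagonal (c * d) :=
  linearMap_ext_rootSpace (H := H) fun χ x hx ↦ by
    rw [LinearMap.comp_apply, diagonal_apply d hx, map_smul, diagonal_apply c hx,
      diagonal_apply _ hx, smul_smul, mul_comm, Pi.mul_apply]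

lemma diagonal_one : diagonal (1 : Weight ℂ H L → ℂ) = LinearMap.id :=
  linearMap_ext_rootSpace (H := H) fun χ x hx ↦ by
    rw [diagonal_apply _ hx, Pi.one_apply, one_smul, LinearMap.id_apply]

/-- The group of diagonal automorphisms of the vector space `L`. -/
noncomputable def diagonalHom : (Weight ℂ H L → ℂˣ) →* (L ≃ₗ[ℂ] L) where
  toFun c := LinearEquiv.ofLinearMap (diagonal fun χ ↦ (c χ : ℂ)) (diagonal fun χ ↦ ((c χ)⁻¹ : ℂˣ))
    (by rw [diagonal_comp, ← diagonal_one (H := H)]; congr; ext; simp)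
    (by rw [diagonal_comp, ← diagonal_one (H := H)]; congr; ext; simp)
  map_one' := by
    ext x
    exact LinearMap.congr_fun (diagonal_one (H := H)) x
  map_mul' c d := by
    ext x
    exact LinearMap.congr_fun (diagonal_comp (H := H) (fun χ ↦ (c χ : ℂ)) (fun χ ↦ (d χ : ℂ))).symm
      x

lemma diagonalHom_apply (c : Weight ℂ H L → ℂˣ) {χ : Weight ℂ H L} {x : L}
    (hx : x ∈ rootSpace H χ) : diagonalHom c x = (c χ : ℂ) • x :=
  diagonal_apply (fun χ ↦ (c χ : ℂ)) hx

lemma linearEquiv_ext_rootSpace {a b : L ≃ₗ[ℂ] L}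
    (h : ∀ χ : Weight ℂ H L, ∀ x ∈ rootSpace H χ, a x = b x) : a = b :=
  LinearEquiv.toLinearMap_injective (linearMap_ext_rootSpace (H := H) h)

end Diagonal

variable {L : Type*} [LieRing L] [LieAlgebra ℂ L] [FiniteDimensional ℂ L] [IsKilling ℂ L]
  {H : LieSubalgebra ℂ L} [H.IsCartanSubalgebra]

namespace WeightCoordinates

variable (C : WeightCoordinates H)

/-- The parametrization of the torus attached to `H` by the values of the simple roots. -/
noncomputable def torusHom : (Fin C.r → ℂˣ) →* (L ≃ₗ[ℂ] L) where
  toFun t := diagonalHom fun χ : Weight ℂ H L ↦ ∏ i, t i ^ C.coeff χ i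
  map_one' := by
    rw [← map_one (diagonalHom (H := H))]
    congr
    ext χ
    simp
  map_mul' t u := by
    rw [← map_mul]
    congr
    ext χ
    simp [mul_zpow, Finset.prod_mul_distrib]

lemma torusHom_apply (t : Fin C.r → ℂˣ) {χ : Weight ℂ H L} {x : L} (hx : x ∈ rootSpace H χ) :
    C.torusHom t x = (∏ i, (t i : ℂ) ^ C.coeff χ i) • x := by
  have := diagonalHom_apply (fun χ : Weight ℂ H L ↦ ∏ i, t i ^ C.coeff χ i) hx
  exact this.trans (by simp)

/-- The one-parameter subgroup with exponents `k` on the simple roots. -/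
noncomputable def oneParameterHom (k : Fin C.r → ℤ) : ℂˣ →* (L ≃ₗ[ℂ] L) :=
  C.torusHom.comp (MonoidHom.pi fun i ↦ zpowGroupHom (k i))

lemma oneParameterHom_apply (k : Fin C.r → ℤ) (t : ℂˣ) {χ : Weight ℂ H L} {x : L}
    (hx : x ∈ rootSpace H χ) :
    C.oneParameterHom k t x = (t : ℂ) ^ (∑ i, C.coeff χ i * k i) • x := by
  have := C.torusHom_apply (fun i ↦ t ^ k i) hx
  refine this.trans ?_
  congr 1
  simp only [Units.val_zpow_eq_zpow_val, ← zpow_mul, mul_comm (k _)]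
  induction (Finset.univ : Finset (Fin C.r)) using Finset.cons_induction with
  | empty => simp
  | cons i s hi ih => rw [Finset.prod_cons, Finset.sum_cons, zpow_add₀ t.ne_zero, ih]

lemma isExpAd_torusHom (t : Fin C.r → ℂˣ) : ∃ h : H, IsExpAd (h : L) (C.torusHom t) := by
  -- Logarithms of the coordinates prescribe the simple roots on `h`. Their branch is immaterial
  -- since weights are integral combinations of simple roots.
  obtain ⟨h, hh⟩ := C.exists_apply_basis_eq fun i ↦ Complex.log (t i)
  refine ⟨h, fun y f ↦ ?_⟩
  have hy : y ∈ ⨆ χ : Weight ℂ H L, (rootSpace H χ).toSubmodule :=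
    iSup_rootSpace_eq_top (H := H) ▸ Submodule.mem_top
  induction hy using Submodule.iSup_induction' with
  | mem χ y hy =>
    have hexp : ∏ i, (t i : ℂ) ^ C.coeff χ i = Complex.exp (χ h) := by
      rw [C.apply_eq, Complex.exp_sum]
      refine Finset.prod_congr rfl fun i _ ↦ ?_
      rw [hh, Complex.exp_int_mul, Complex.exp_log (t i).ne_zero]
    have hpow (n : ℕ) : (ad ℂ L h ^ n) y = χ h ^ n • y := by
      induction n with
      | zero => simp
      | succ n ih =>
        have : ⁅(h : L), y⁆ = χ h • y := IsKilling.lie_eq_smul_of_mem_rootSpace hy h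
        rw [pow_succ', Module.End.mul_apply, ih, map_smul, ad_apply, this, smul_smul, pow_succ]
    rw [C.torusHom_apply t hy, hexp, map_smul, smul_eq_mul, Complex.exp_eq_exp_ℂ]
    have := (NormedSpace.expSeries_div_hasSum_exp (χ h)).mul_right (f y)
    refine this.congr_fun fun n ↦ ?_
    rw [hpow, map_smul, smul_eq_mul, div_eq_inv_mul, mul_assoc]
  | zero => simp
  | add y z _ _ hy hz => simpa [mul_add] using hy.add hz

lemma torusHom_mem_adjointGroup (t : Fin C.r → ℂˣ) : C.torusHom t ∈ adjointGroup L :=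
  Subgroup.subset_closure ((C.isExpAd_torusHom t).imp' _ fun _ ↦ id)

lemma isAlgebraicRep_torusHom : IsAlgebraicRep C.torusHom := by
  intro y f
  have hy : y ∈ ⨆ χ : Weight ℂ H L, (rootSpace H χ).toSubmodule :=
    iSup_rootSpace_eq_top (H := H) ▸ Submodule.mem_top
  induction hy using Submodule.iSup_induction' with
  | mem χ y hy =>
    let N := ∑ i, (C.coeff χ i).natAbs
    have hN (i) : 0 ≤ N + C.coeff χ i := by
      have : (C.coeff χ i).natAbs ≤ N :=
        Finset.single_le_sum (f := fun i ↦ (C.coeff χ i).natAbs) (fun _ _ ↦ Nat.zero_le _)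
          (Finset.mem_univ i)
      lia
    refine ⟨N, MvPolynomial.C (f y) * ∏ i, MvPolynomial.X i ^ (N + C.coeff χ i).toNat, fun t ↦ ?_⟩
    rw [C.torusHom_apply t hy, map_smul, smul_eq_mul, ← mul_assoc, ← Finset.prod_pow,
      ← Finset.prod_mul_distrib, mul_comm, map_mul, MvPolynomial.eval_C, map_prod]
    congr 1
    refine Finset.prod_congr rfl fun i _ ↦ ?_
    rw [map_pow, MvPolynomial.eval_X, ← zpow_natCast, ← zpow_natCast, ← zpow_add₀ (t i).ne_zero,
      Int.toNat_of_nonneg (hN i)]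
  | zero => exact ⟨0, 0, by simp⟩
  | add y z _ _ hy hz =>
    obtain ⟨M, p, hp⟩ := hy
    obtain ⟨N, q, hq⟩ := hz
    refine ⟨M + N, (∏ i, MvPolynomial.X i) ^ N * p + (∏ i, MvPolynomial.X i) ^ M * q, fun t ↦ ?_⟩
    simp only [map_add, map_mul, map_pow, map_prod, MvPolynomial.eval_X, ← hp, ← hq]
    ring

/-- The torus attached to `H`. -/
noncomputable def torus : Subgroup (L ≃ₗ[ℂ] L) := C.torusHom.range

lemma isOneParameterSubgroup (k : Fin C.r → ℤ) :
    IsOneParameterSubgroup C.torus (C.oneParameterHom k) := by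
  refine ⟨fun t ↦ ⟨_, rfl⟩, fun y f ↦ ?_⟩
  have hy : y ∈ ⨆ χ : Weight ℂ H L, (rootSpace H χ).toSubmodule :=
    iSup_rootSpace_eq_top (H := H) ▸ Submodule.mem_top
  induction hy using Submodule.iSup_induction' with
  | mem χ y hy =>
    let d := ∑ i, C.coeff χ i * k i
    refine ⟨d.natAbs, Polynomial.C (f y) * Polynomial.X ^ (d.natAbs + d).toNat, fun t ↦ ?_⟩
    rw [C.oneParameterHom_apply k t hy, map_smul, smul_eq_mul, ← mul_assoc, Polynomial.eval_mul,
      Polynomial.eval_C, Polynomial.eval_pow, Polynomial.eval_X, mul_comm]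
    congr 1
    rw [← zpow_natCast, ← zpow_natCast, ← zpow_add₀ t.ne_zero, Int.toNat_of_nonneg (by lia)]
  | zero => exact ⟨0, 0, by simp⟩
  | add y z _ _ hy hz =>
    obtain ⟨M, p, hp⟩ := hy
    obtain ⟨N, q, hq⟩ := hz
    refine ⟨M + N, Polynomial.X ^ N * p + Polynomial.X ^ M * q, fun t ↦ ?_⟩
    simp only [Polynomial.eval_add, Polynomial.eval_mul, Polynomial.eval_pow, Polynomial.eval_X,
      ← hp, ← hq, map_add]
    ring

variable {C} {k : Fin C.r → ℤ}

/-- The eigenvalues of the element `2` of a separating one-parameter subgroup are distinct. -/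
lemma two_zpow_injective
    (hk : Function.Injective fun χ : Weight ℂ H L ↦ ∑ i, C.coeff χ i * k i) :
    Function.Injective fun χ : Weight ℂ H L ↦ (2 : ℂ) ^ (∑ i, C.coeff χ i * k i) := fun χ ψ h ↦ by
  refine hk (zpow_right_injective₀ (a := (2 : ℝ)) two_pos (by norm_num) ?_)
  have := congr_arg norm h
  simpa [norm_zpow] using this

/-- The value at `2` alone has distinct eigenvalues on distinct root spaces, so a stable subspace
contains the root components of its elements, on which the torus acts by scalars. -/
lemma isRegularOneParameterSubgroup
    (hk : Function.Injective fun χ : Weight ℂ H L ↦ ∑ i, C.coeff χ i * k i) :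
    IsRegularOneParameterSubgroup C.torus (C.oneParameterHom k) := by
  classical
  have := Fintype.ofFinite (Weight ℂ H L)
  refine ⟨C.isOneParameterSubgroup k, ?_⟩
  rintro W hW _ ⟨t, rfl⟩ _ ⟨x, hx, rfl⟩
  obtain ⟨y, hy, rfl⟩ := exists_eq_sum_rootSpace (H := H) x
  have hmem := mem_of_sum_mem_of_eigen
    (D := (C.oneParameterHom k (Units.mk0 2 two_ne_zero)).toLinearMap)
    (fun x hx ↦ hW _ ⟨x, hx, rfl⟩) (two_zpow_injective hk)
    (fun χ ↦ C.oneParameterHom_apply k _ (hy χ)) hx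
  rw [map_sum]
  refine sum_mem fun χ _ ↦ ?_
  have := C.torusHom_apply t (hy χ)
  exact this ▸ W.smul_mem _ (hmem χ)

/-- A linear automorphism commuting with a separating one-parameter subgroup preserves the root
spaces. -/
lemma apply_mem_rootSpace
    (hk : Function.Injective fun χ : Weight ℂ H L ↦ ∑ i, C.coeff χ i * k i) {a : L ≃ₗ[ℂ] L}
    (ha : ∀ x, a (C.oneParameterHom k (Units.mk0 2 two_ne_zero) x) =
      C.oneParameterHom k (Units.mk0 2 two_ne_zero) (a x))
    {χ : Weight ℂ H L} {x : L} (hx : x ∈ rootSpace H χ) : a x ∈ rootSpace H χ := by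
  classical
  have := Fintype.ofFinite (Weight ℂ H L)
  obtain ⟨y, hy, hsum⟩ := exists_eq_sum_rootSpace (H := H) (a x)
  let D : End ℂ L := (C.oneParameterHom k (Units.mk0 2 two_ne_zero)).toLinearMap
  let W := D.eigenspace ((2 : ℂ) ^ (∑ i, C.coeff χ i * k i))
  have hax : a x ∈ W := by
    have h₁ := ha x
    rw [C.oneParameterHom_apply k _ hx, map_smul] at h₁
    exact Module.End.mem_eigenspace_iff.mpr h₁.symm
  have hy' (ψ : Weight ℂ H L) : D (y ψ) = (2 : ℂ) ^ (∑ i, C.coeff ψ i * k i) • y ψ :=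
    C.oneParameterHom_apply k _ (hy ψ)
  have hmem := mem_of_sum_mem_of_eigen (D := D) (W := W)
    (fun x hx ↦ by rw [Module.End.mem_eigenspace_iff.mp hx]; exact W.smul_mem _ hx)
    (two_zpow_injective hk) hy' (hsum ▸ hax)
  rw [← hsum, Finset.sum_eq_single χ _ (by simp)]
  · exact hy χ
  · intro ψ _ hψ
    have h := (hy' ψ).symm.trans (Module.End.mem_eigenspace_iff.mp (hmem ψ))
    rw [← sub_eq_zero, ← sub_smul, smul_eq_zero, sub_eq_zero] at h
    exact h.resolve_left fun h' ↦ hψ (two_zpow_injective hk h')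

end WeightCoordinates

end NullSpaces

/-! ### Maximality of the torus. -/

namespace NullSpaces

open Module Filter Topology LieAlgebra LieModule

variable {L : Type*} [LieRing L] [LieAlgebra ℂ L] [FiniteDimensional ℂ L] [IsKilling ℂ L]
  {H : LieSubalgebra ℂ L} [H.IsCartanSubalgebra]

lemma lie_mem_rootSpace_add {L : Type*} [LieRing L] [LieAlgebra ℂ L]
    {H : LieSubalgebra ℂ L} [H.IsCartanSubalgebra] {χ ψ ω : Weight ℂ H L}
    (h : (χ : H → ℂ) = ψ + ω) {x y : L}
    (hx : x ∈ rootSpace H ψ) (hy : y ∈ rootSpace H ω) : ⁅x, y⁆ ∈ rootSpace H χ := by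
  rw [h]
  exact lie_mem_genWeightSpace_of_mem_genWeightSpace hx hy

lemma exists_mem_rootSpace_of_mem {L : Type*} [LieRing L] [LieAlgebra ℂ L] [FiniteDimensional ℂ L]
    {H : LieSubalgebra ℂ L} [H.IsCartanSubalgebra] {h : L} (hh : h ∈ H) (h0 : h ≠ 0) :
    ∃ χ : Weight ℂ H L, χ.IsZero ∧ h ∈ rootSpace H χ := by
  have hmem : h ∈ rootSpace H (0 : H → ℂ) := by simpa using hh
  exact ⟨⟨0, fun hbot ↦ h0 (by simpa [hbot] using hmem)⟩, rfl, hmem⟩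

lemma WeightCoordinates.eq_of_apply_eq (C : WeightCoordinates H) {h h' : H}
    (hh : ∀ i, C.simple i h = C.simple i h') : h = h' := by
  refine (evalEquiv ℂ H).injective (C.basis.ext fun i ↦ ?_)
  simpa [C.basis_apply] using hh i

/-- An automorphism which preserves the root spaces lies in the torus. -/
lemma WeightCoordinates.exists_torusHom_eq (C : WeightCoordinates H) {a : L ≃ₗ[ℂ] L}
    (hlie : ∀ y z, a ⁅y, z⁆ = ⁅a y, a z⁆)
    (hroot : ∀ (χ : Weight ℂ H L), ∀ x ∈ rootSpace H χ, a x ∈ rootSpace H χ) :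
    ∃ t, C.torusHom t = a := by
  have hH (h : H) : a h ∈ H := by
    by_cases h0 : (h : L) = 0
    · simp [h0]
    · obtain ⟨χ, hχ, hmem⟩ := exists_mem_rootSpace_of_mem h.2 h0
      exact (mem_rootSpace_of_isZero hχ).mp (hroot χ h hmem)
  have hsimple (i) : (C.simple i).IsNonZero := fun h0 ↦ C.basis.ne_zero i <| by
    rw [C.basis_apply, Weight.coe_toLinear_eq_zero_iff.mpr h0]
  -- The automorphism carries the eigenvalue of `h` on a simple root space to that of `a h` on the
  -- same space; simple roots separate the points of `H`.
  have hfix (h : H) : a h = h := by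
    refine congr_arg Subtype.val (C.eq_of_apply_eq (h := ⟨a h, hH h⟩) (h' := h) fun i ↦ ?_)
    obtain ⟨x, hx, hx0⟩ := (C.simple i).exists_ne_zero
    have hx' : ⁅(h : L), x⁆ = C.simple i h • x := IsKilling.lie_eq_smul_of_mem_rootSpace hx h
    have hax : ⁅a h, a x⁆ = C.simple i ⟨a h, hH h⟩ • a x :=
      IsKilling.lie_eq_smul_of_mem_rootSpace (hroot _ x hx) ⟨a h, hH h⟩
    rw [← hlie, hx', map_smul] at hax
    exact (smul_left_injective ℂ (a.map_ne_zero_iff.mpr hx0) hax).symm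
  have hscalar (χ : Weight ℂ H L) (hχ : χ.IsNonZero) :
      ∃ c : ℂˣ, ∀ x ∈ rootSpace H χ, a x = (c : ℂ) • x := by
    obtain ⟨x, hx, hx0⟩ := χ.exists_ne_zero
    obtain ⟨c, hc⟩ := mem_span_of_mem_rootSpace hχ hx hx0 (hroot χ x hx)
    have hc0 : c ≠ 0 := by
      rintro rfl
      exact hx0 (a.map_eq_zero_iff.mp (by simpa using hc))
    refine ⟨Units.mk0 c hc0, fun y hy ↦ ?_⟩
    obtain ⟨d, rfl⟩ := mem_span_of_mem_rootSpace hχ hx hx0 hy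
    rw [map_smul, hc, smul_comm, Units.val_mk0]
  choose t ht using fun i ↦ hscalar _ (hsimple i)
  have hnonzero (χ : Weight ℂ H L) (hχ : χ.IsNonZero) :
      ∀ x ∈ rootSpace H χ, a x = (∏ i, (t i : ℂ) ^ C.coeff χ i) • x := by
    refine C.induction (fun χ ↦ χ.IsNonZero →
      ∀ x ∈ rootSpace H χ, a x = (∏ i, (t i : ℂ) ^ C.coeff χ i) • x) ?_ ?_ ?_ χ hχ hχ
    · intro i _ x hx
      rw [ht i x hx, C.coeff_simple, Finset.prod_eq_single i] <;> simp +contextual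
    · intro χ ih hχ f hf
      replace hχ : χ.IsNonZero := by simpa using hχ.neg
      obtain ⟨h, e, f', isSl2, he, hf'⟩ := IsKilling.exists_isSl2Triple_of_weight_isNonZero hχ
      obtain ⟨u, hu⟩ := hscalar (-χ) (by simpa using hχ.neg)
      obtain rfl := isSl2.h_eq_coroot hχ he hf'
      have h1 := hfix (IsKilling.coroot χ)
      -- The coroot is fixed, so the scalars on opposite root spaces are inverse to each other.
      rw [← isSl2.lie_e_f, hlie, ih hχ e he, hu f' (by simpa using hf'), smul_lie, lie_smul,
        smul_smul, isSl2.lie_e_f] at h1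
      have h2 := smul_left_injective ℂ isSl2.h_ne_zero (h1.trans (one_smul ℂ _).symm)
      rw [hu f hf, eq_inv_of_mul_eq_one_right h2, C.coeff_neg]
      simp
    · intro χ ψ i hχ hψ h ih _ x hx
      obtain ⟨e, he, he0⟩ := (C.simple i).exists_ne_zero
      obtain ⟨y, hy, hy0⟩ := ψ.exists_ne_zero
      obtain ⟨c, rfl⟩ := mem_span_of_mem_rootSpace hχ (lie_mem_rootSpace_add h hy he)
        (lie_ne_zero_of_mem_rootSpace hψ (hsimple i) h hy hy0 he he0) hx
      rw [map_smul, hlie, ih hψ y hy, ht i e he, C.coeff_add h, C.coeff_simple]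
      simp only [Pi.add_apply, zpow_add₀ (t _).ne_zero, Finset.prod_mul_distrib]
      rw [Finset.prod_eq_single (f := fun j ↦ (t j : ℂ) ^ (Pi.single i 1 : Fin C.r → ℤ) j) i
        (by simp +contextual) (by simp)]
      rw [smul_lie, lie_smul, Pi.single_eq_same, zpow_one, smul_smul, smul_smul, smul_smul]
      congr 1
      ring
  refine ⟨t, linearEquiv_ext_rootSpace (H := H) fun χ x hx ↦ ?_⟩
  rw [C.torusHom_apply t hx]
  by_cases hχ : χ.IsZero
  · have := hfix ⟨x, (mem_rootSpace_of_isZero hχ).mp hx⟩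
    simpa [C.coeff_of_isZero hχ] using this.symm
  · exact (hnonzero χ hχ x hx).symm

/-- An element of a larger torus commutes with a separating one-parameter subgroup, so it preserves
the root spaces. Being a Lie automorphism, it is determined by its scalars on the simple root
spaces. -/
lemma WeightCoordinates.isMaximalTorus (C : WeightCoordinates H) : IsMaximalTorus C.torus := by
  refine ⟨⟨?_, C.r, C.torusHom, C.isAlgebraicRep_torusHom, rfl⟩, ?_⟩
  · rintro _ ⟨t, rfl⟩
    exact C.torusHom_mem_adjointGroup t
  · rintro T' ⟨hT', n, φ, -, hφ⟩ hle a ha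
    obtain ⟨k, hk⟩ := C.exists_degree
    refine C.exists_torusHom_eq (map_lie_of_mem_adjointGroup (hT' ha)) fun χ x hx ↦
      apply_mem_rootSpace hk (fun y ↦ ?_) hx
    obtain ⟨s, hs⟩ := hφ.ge ha
    obtain ⟨u, hu⟩ := hφ.ge (hle ((C.isOneParameterSubgroup k).1 (Units.mk0 2 two_ne_zero)))
    rw [← hs, ← hu]
    change (φ s * φ u) y = (φ u * φ s) y
    rw [← map_mul, ← map_mul, mul_comm]

end NullSpaces

/-! ### Solvable nullspaces and Borel subalgebras. -/

namespace NullSpaces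

open Module Filter Topology LieAlgebra LieModule

section

variable {L : Type*} [LieRing L] [LieAlgebra ℂ L]

lemma isSolvable_of_derivedSeries_one (h : IsSolvable (derivedSeries ℂ L 1)) : IsSolvable L := by
  obtain ⟨k, hk⟩ := IsSolvable.solvable ℂ (derivedSeries ℂ L 1)
  rw [LieIdeal.derivedSeries_eq_bot_iff, derivedSeries_def, ← derivedSeriesOfIdeal_add] at hk
  exact IsSolvable.mk (R := ℂ) hk

/-- A solvable Lie algebra does not contain an `sl₂`-triple. -/
lemma not_isSl2Triple_of_isSolvable [IsSolvable L] {h e f : L} (t : IsSl2Triple h e f) : False := by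
  obtain ⟨k, hk⟩ := IsSolvable.solvable ℂ L
  have key (n : ℕ) : e ∈ derivedSeries ℂ L n ∧ f ∈ derivedSeries ℂ L n := by
    induction n with
    | zero => simp [derivedSeries_def]
    | succ n ih =>
      rw [derivedSeries_def, derivedSeriesOfIdeal_succ, ← derivedSeries_def]
      have hh : h ∈ derivedSeries ℂ L n := by
        rw [← t.lie_e_f]
        exact lie_mem_right ℂ L _ _ _ ih.2
      constructor
      · have := Submodule.smul_mem ⁅derivedSeries ℂ L n, derivedSeries ℂ L n⁆.toSubmodule (2⁻¹ : ℂ)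
          (LieSubmodule.lie_mem_lie hh ih.1)
        rw [t.lie_h_e_smul ℂ, smul_smul, inv_mul_cancel₀ two_ne_zero, one_smul] at this
        exact this
      · have := Submodule.smul_mem ⁅derivedSeries ℂ L n, derivedSeries ℂ L n⁆.toSubmodule (-2⁻¹ : ℂ)
          (LieSubmodule.lie_mem_lie hh ih.2)
        rw [t.lie_h_f_nsmul, ← ofNat_smul_eq_nsmul ℂ, smul_neg, neg_smul, neg_neg, smul_smul,
          inv_mul_cancel₀ two_ne_zero, one_smul] at this
        exact this
  have he := (key k).1
  rw [hk, LieSubmodule.mem_bot] at he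
  apply t.h_ne_zero
  rw [← t.lie_e_f, he, zero_lie]

variable [FiniteDimensional ℂ L]

/-- Cartan's criterion: the Killing form of `L` vanishes between `[B, B]` and `B`, so the derived
algebra of `[B, B]` acts nilpotently on `L` and is a nilpotent Lie algebra. -/
lemma isSolvable_of_isNullspace (B : LieSubalgebra ℂ L) (hB : IsNullspace B.toSubmodule) :
    IsSolvable B := by
  set D := derivedSeries ℂ B 1 with hD
  have hκ : ∀ x ∈ D, ∀ z : B, killingForm ℂ L (x : B) z = 0 := by
    intro x hx z
    rw [hD, derivedSeries_def, derivedSeriesOfIdeal_succ, derivedSeriesOfIdeal_zero,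
      ← LieSubmodule.mem_toSubmodule, LieSubmodule.lieIdeal_oper_eq_linear_span'] at hx
    induction hx using Submodule.span_induction with
    | mem x hx =>
      obtain ⟨a, -, b, -, rfl⟩ := hx
      exact hB a a.2 b b.2 z z.2
    | zero => simp
    | add x y _ _ hx hy => simp [hx, hy]
    | smul c x _ hx => simp [hx]
  have htrace : traceForm ℂ D L = 0 := by
    ext x y
    exact hκ x x.2 y
  have hnil := isNilpotent_derivedSeries_of_traceForm_eq_zero htrace
  refine isSolvable_of_derivedSeries_one (isSolvable_of_derivedSeries_one ?_)
  let g : derivedSeries ℂ D 1 →ₗ[ℂ] L :=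
    B.toSubmodule.subtype ∘ₗ D.toSubmodule.subtype ∘ₗ (derivedSeries ℂ D 1).toSubmodule.subtype
  have : LieModule.IsNilpotent (derivedSeries ℂ D 1) (derivedSeries ℂ D 1) :=
    Function.Injective.lieModuleIsNilpotent (f := LieHom.id) (g := g)
      (fun _ _ ↦ rfl) fun x y h ↦ Subtype.ext (Subtype.ext (Subtype.ext h))
  infer_instance

end

variable {L : Type*} [LieRing L] [LieAlgebra ℂ L] [FiniteDimensional ℂ L] [IsKilling ℂ L]
  {H : LieSubalgebra ℂ L} [H.IsCartanSubalgebra]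

/-- A solvable `B'` above `B` is stable under `ad l`, so it contains the root components of its
elements. A nonzero component for a root `χ` whose opposite root space is in `B` would generate an
`sl₂` inside `B'`. -/
lemma isBorelSubalgebra_of_isNullspace {B : LieSubalgebra ℂ L} (hB : IsNullspace B.toSubmodule)
    (hH : H ≤ B) (hroot : ∀ χ : Weight ℂ H L, χ.IsNonZero →
      (rootSpace H χ).toSubmodule ≤ B.toSubmodule ∨
        (rootSpace H (-χ)).toSubmodule ≤ B.toSubmodule) : IsBorelSubalgebra B := by
  classical
  have := Fintype.ofFinite (Weight ℂ H L)
  refine ⟨isSolvable_of_isNullspace B hB, fun B' hB' hle x hx ↦ ?_⟩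
  obtain ⟨l⟩ := nonempty_coweight H
  obtain ⟨y, hy, rfl⟩ := exists_eq_sum_rootSpace (H := H) x
  have hmem := mem_of_sum_mem_of_eigen (D := ad ℂ L l.elt) (W := B'.toSubmodule)
    (fun z hz ↦ B'.lie_mem (hle (hH l.elt.2)) hz)
    (c := fun χ ↦ (l.deg χ : ℂ)) (Int.cast_injective.comp l.deg_injective)
    (fun χ ↦ mem_gradedPiece.mp (l.rootSpace_le_gradedPiece χ (hy χ))) hx
  refine sum_mem fun χ _ ↦ ?_
  by_cases hχ : χ.IsZero
  · exact hH ((mem_rootSpace_of_isZero hχ).mp (hy χ))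
  refine (hroot χ hχ).elim (fun h ↦ h (hy χ)) fun hneg ↦ ?_
  by_cases h0 : y χ = 0
  · simp [h0]
  obtain ⟨h, e, f, t, he, hf⟩ := IsKilling.exists_isSl2Triple_of_weight_isNonZero hχ
  obtain ⟨c, rfl⟩ := mem_span_of_mem_rootSpace hχ (hy χ) h0 he
  have heB : c • y χ ∈ B' := B'.smul_mem c (hmem χ)
  have hfB : f ∈ B' := hle (hneg hf)
  have hhB : h ∈ B' := t.lie_e_f ▸ B'.lie_mem heB hfB
  refine (not_isSl2Triple_of_isSolvable (L := B') (h := ⟨h, hhB⟩) (e := ⟨_, heB⟩) (f := ⟨f, hfB⟩)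
    ⟨?_, ?_, ?_, ?_⟩).elim
  · exact fun h0 ↦ t.h_ne_zero (congr_arg Subtype.val h0)
  · exact Subtype.ext t.lie_e_f
  · exact Subtype.ext t.lie_h_e_nsmul
  · exact Subtype.ext t.lie_h_f_nsmul

end NullSpaces

/-! ### Limits along one-parameter subgroups. -/

namespace NullSpaces

open Module Filter Topology LieAlgebra LieModule

section

variable {L : Type*} [LieRing L] [LieAlgebra ℂ L]

/-- The limit of a subspace can be computed from a rescaled basis. -/
lemma isLimitAtZero_of_tendsto {J : Type*} [Fintype J] {μ : ℂˣ →* (L ≃ₗ[ℂ] L)} {V : Submodule ℂ L}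
    {v u : J → L} (hv : LinearIndependent ℂ v) (hvV : Submodule.span ℂ (Set.range v) = V)
    (hu : LinearIndependent ℂ u) (c : J → ℂˣ → ℂˣ)
    (h : ∀ j (f : Dual ℂ L), Tendsto (fun t ↦ f ((c j t : ℂ) • μ t (v j)))
      (comap (fun t : ℂˣ ↦ (t : ℂ)) (𝓝 0)) (𝓝 (f (u j)))) :
    IsLimitAtZero μ V (Submodule.span ℂ (Set.range u)) := by
  let σ := (Fintype.equivFin J).symm
  refine ⟨Fintype.card J, fun t i ↦ (c (σ i) t : ℂ) • μ t (v (σ i)), u ∘ σ,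
    ⟨hu.comp _ σ.injective, ?_⟩, .of_forall fun t ↦ ⟨?_, ?_⟩, fun i f ↦ h (σ i) f⟩
  · rw [σ.surjective.range_comp]
  · exact ((hv.map' (μ t).toLinearMap (μ t).ker).comp _ σ.injective).units_smul
      fun i ↦ c (σ i) t
  · simp only [← hvV, Submodule.map_span, ← Set.range_comp]
    refine le_antisymm ?_ ?_
    · rw [Submodule.span_le]
      rintro _ ⟨i, rfl⟩
      exact Submodule.smul_mem _ _ (Submodule.subset_span ⟨σ i, rfl⟩)
    · rw [Submodule.span_le]
      rintro _ ⟨j, rfl⟩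
      have := Submodule.smul_mem (Submodule.span ℂ (Set.range
        fun i ↦ (c (σ i) t : ℂ) • μ t (v (σ i)))) ((c j t)⁻¹ : ℂˣ)
        (Submodule.subset_span ⟨σ.symm j, rfl⟩)
      simpa [smul_smul] using this

variable [FiniteDimensional ℂ L]

/-- The limit of a nullspace is a nullspace. -/
lemma IsNullspace.of_isLimitAtZero {μ : ℂˣ →* (L ≃ₗ[ℂ] L)} {V W : Submodule ℂ L}
    (hμ : ∀ t x y, μ t ⁅x, y⁆ = ⁅μ t x, μ t y⁆) (hV : IsNullspace V) (h : IsLimitAtZero μ V W) :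
    IsNullspace W ∧ finrank ℂ W = finrank ℂ V := by
  obtain ⟨n, v, u, ⟨hu, rfl⟩, hv, hlim⟩ := h
  -- The limit is along a nontrivial filter, since nonzero scalars accumulate at `0`; uniqueness of
  -- limits depends on it.
  have : (comap (fun t : ℂˣ ↦ (t : ℂ)) (𝓝 0)).NeBot := by
    rw [comap_neBot_iff_frequently]
    have : ∃ᶠ z : ℂ in 𝓝[≠] 0, z ≠ 0 := 
      (eventually_mem_nhdsWithin (s := {(0 : ℂ)}ᶜ)).frequently
    exact (this.filter_mono nhdsWithin_le_nhds).mono fun z hz ↦ ⟨Units.mk0 z hz, rfl⟩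
  refine ⟨?_, ?_⟩
  · have hbasis (i j k : Fin n) : w (u i) (u j) (u k) = 0 := by
      have hbr (f : Dual ℂ L) : Tendsto (fun t ↦ f ⁅v t i, v t j⁆)
          (comap (fun t : ℂˣ ↦ (t : ℂ)) (𝓝 0)) (𝓝 (f ⁅u i, u j⁆)) :=
        tendsto_bilin ((toEnd ℂ L L : L →ₗ[ℂ] End ℂ L).compr₂ f) (hlim i) (hlim j)
      refine tendsto_nhds_unique (tendsto_bilin (killingForm ℂ L) hbr (hlim k))
        (tendsto_const_nhds.congr' ?_)
      filter_upwards [hv] with t ht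
      let g : L ≃ₗ⁅ℂ⁆ L := { μ t with map_lie' := hμ t _ _ }
      have hmem (i : Fin n) : v t i ∈ V.map (g.toLinearEquiv : L →ₗ[ℂ] L) :=
        ht.2 ▸ Submodule.subset_span ⟨i, rfl⟩
      exact (hV.map g _ (hmem i) _ (hmem j) _ (hmem k)).symm
    intro x hx y hy z hz
    induction hx using Submodule.span_induction with
    | mem x hx =>
      induction hy using Submodule.span_induction with
      | mem y hy =>
        induction hz using Submodule.span_induction with
        | mem z hz =>
          obtain ⟨i, rfl⟩ := hx
          obtain ⟨j, rfl⟩ := hy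
          obtain ⟨k, rfl⟩ := hz
          exact hbasis i j k
        | zero => simp [w]
        | add a b _ _ ha hb => simpa [w, ha] using by simp_all [w]
        | smul c a _ ha => simp_all [w]
      | zero => simp [w]
      | add a b _ _ ha hb => simp_all [w]
      | smul c a _ ha => simp_all [w]
    | zero => simp [w]
    | add a b _ _ ha hb => simp_all [w]
    | smul c a _ ha => simp_all [w]
  · obtain ⟨t, ht, htV⟩ := hv.exists
    rw [finrank_span_eq_card hu, ← finrank_span_eq_card ht, htV]
    exact LinearEquiv.finrank_map_eq (μ t) V

end

variable {L : Type*} [LieRing L] [LieAlgebra ℂ L] [FiniteDimensional ℂ L] [IsKilling ℂ L]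
  {H : LieSubalgebra ℂ L} [H.IsCartanSubalgebra]

lemma WeightCoordinates.oneParameterHom_apply_of_mem (C : WeightCoordinates H) (k : Fin C.r → ℤ)
    (t : ℂˣ) {h : L} (hh : h ∈ H) : C.oneParameterHom k t h = h := by
  by_cases h0 : h = 0
  · simp [h0]
  obtain ⟨χ, hχ, hmem⟩ := exists_mem_rootSpace_of_mem hh h0
  rw [C.oneParameterHom_apply k t hmem, C.coeff_of_isZero hχ]
  simp

/-- The limit of a line in the sum of two root spaces is one of the root spaces. -/
lemma WeightCoordinates.exists_tendsto {C : WeightCoordinates H} {k : Fin C.r → ℤ}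
    (hk : Function.Injective fun χ : Weight ℂ H L ↦ ∑ i, C.coeff χ i * k i)
    {χ ψ : Weight ℂ H L} (hne : χ ≠ ψ) {x : L} (hx0 : x ≠ 0)
    (hx : x ∈ (rootSpace H χ).toSubmodule ⊔ (rootSpace H ψ).toSubmodule) :
    ∃ (c : ℂˣ → ℂˣ) (u : L), u ≠ 0 ∧ (u ∈ rootSpace H χ ∨ u ∈ rootSpace H ψ) ∧
      ∀ f : Dual ℂ L, Tendsto (fun t ↦ f ((c t : ℂ) • C.oneParameterHom k t x))
        (comap (fun t : ℂˣ ↦ (t : ℂ)) (𝓝 0)) (𝓝 (f u)) := by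
  wlog hlt : ∑ i, C.coeff χ i * k i < ∑ i, C.coeff ψ i * k i generalizing χ ψ
  · obtain ⟨c, u, h₁, h₂, h₃⟩ := this hne.symm (sup_comm (a := (rootSpace H χ).toSubmodule) _ ▸ hx)
      (lt_of_le_of_ne (not_lt.mp hlt) fun h ↦ hne (hk h).symm)
    exact ⟨c, u, h₁, h₂.symm, h₃⟩
  obtain ⟨p, hp, q, hq, rfl⟩ := Submodule.mem_sup.mp hx
  set d := ∑ i, C.coeff χ i * k i with hd
  set d' := ∑ i, C.coeff ψ i * k i with hd'
  by_cases hp0 : p = 0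
  · refine ⟨fun t ↦ t ^ (-d'), q, by simpa [hp0] using hx0, Or.inr hq, fun f ↦ ?_⟩
    refine tendsto_const_nhds.congr fun t ↦ ?_
    rw [hp0, zero_add, C.oneParameterHom_apply k t hq, smul_smul, Units.val_zpow_eq_zpow_val,
      ← zpow_add₀ t.ne_zero, ← hd', neg_add_cancel, zpow_zero, one_smul]
  -- The smaller exponent dominates as `t → 0`: after rescaling by `t ^ (-d)` the other component
  -- carries a positive power of `t`.
  · refine ⟨fun t ↦ t ^ (-d), p, hp0, Or.inl hp, fun f ↦ ?_⟩
    obtain ⟨n, hn⟩ : ∃ n : ℕ, d' = d + (n + 1 : ℕ) := ⟨(d' - d - 1).toNat, by lia⟩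
    have hpow : Tendsto (fun t : ℂˣ ↦ (t : ℂ) ^ (n + 1)) (comap (fun t : ℂˣ ↦ (t : ℂ)) (𝓝 0))
        (𝓝 0) :=
      ((continuous_pow (n + 1)).tendsto' 0 0 (by simp)).comp tendsto_comap
    have hlim := (hpow.mul_const (f q)).const_add (f p)
    rw [zero_mul, add_zero] at hlim
    refine hlim.congr fun t ↦ ?_
    rw [map_add, C.oneParameterHom_apply k t hp, C.oneParameterHom_apply k t hq, smul_add,
      smul_smul, smul_smul, Units.val_zpow_eq_zpow_val, ← zpow_add₀ t.ne_zero,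
      ← zpow_add₀ t.ne_zero, ← hd, ← hd', hn, neg_add_cancel, neg_add_cancel_left, zpow_zero,
      one_smul, zpow_natCast, map_add, map_smul, smul_eq_mul]

variable (b : (IsKilling.rootSystem H).Base)

lemma linearIndependent_sumElim_rootPlane {x : PosRoot b → L}
    (hx : ∀ α, x α ∈ rootPlane b (some α)) (hx0 : ∀ α, x α ≠ 0) :
    LinearIndependent ℂ (Sum.elim (fun i ↦ (finBasis ℂ H i : L)) x) := by
  have hH : Submodule.span ℂ (Set.range fun i ↦ (finBasis ℂ H i : L)) ≤ rootPlane b none := by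
    rw [Submodule.span_le]
    rintro _ ⟨i, rfl⟩
    exact (finBasis ℂ H i).2
  refine LinearIndependent.sum_type ?_ ?_ ?_
  · exact (finBasis ℂ H).linearIndependent.map' H.toSubmodule.subtype (Submodule.ker_subtype _)
  · exact iSupIndep.linearIndependent _ ((iSupIndep_rootPlane b).comp (Option.some_injective _))
      hx hx0
  · refine ((iSupIndep_rootPlane b) none).mono hH ?_
    rw [Submodule.span_le]
    rintro _ ⟨α, rfl⟩
    exact le_iSup₂_of_le (f := fun o (_ : o ≠ none) ↦ rootPlane b o) (some α) (by simp) le_rfl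
      (hx α)

/-- A suitable limit of a maximal nullspace is a Borel subalgebra. -/
lemma IsMaximalNullspace.exists_isLimitAtZero {V : Submodule ℂ L} (hV : IsMaximalNullspace V)
    (hH : H.toSubmodule ≤ V) {C : WeightCoordinates H} {k : Fin C.r → ℤ}
    (hk : Function.Injective fun χ : Weight ℂ H L ↦ ∑ i, C.coeff χ i * k i) :
    ∃ B : LieSubalgebra ℂ L, IsLimitAtZero (C.oneParameterHom k) V B.toSubmodule ∧
      IsBorelSubalgebra B := by
  classical
  obtain ⟨b⟩ := (IsKilling.rootSystem H).nonempty_base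
  have := Fintype.ofFinite (PosRoot b)
  have hline (α : PosRoot b) : ∃ v : L, v ≠ 0 ∧ v ∈ rootPlane b (some α) ∧
      V ⊓ rootPlane b (some α) = Submodule.span ℂ {v} := by
    obtain ⟨v, hv0, hv⟩ := finrank_eq_one_iff'.mp (hV.finrank_inf_rootPlane hH α)
    refine ⟨v, by simpa using hv0, v.2.2, le_antisymm (fun x hx ↦ ?_) ?_⟩
    · obtain ⟨c, hc⟩ := hv ⟨x, hx⟩
      exact Submodule.mem_span_singleton.mpr ⟨c, congr_arg Subtype.val hc⟩
    · exact (Submodule.span_singleton_le_iff_mem _ _).mpr v.2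
  choose v hv0 hv hvV using hline
  choose c u hu0 hu hlim using fun α ↦
    WeightCoordinates.exists_tendsto hk (PosRoot.ne_neg b α α) (hv0 α) (hv α)
  have huplane (α : PosRoot b) : u α ∈ rootPlane b (some α) :=
    (hu α).elim (fun h ↦ Submodule.mem_sup_left h) fun h ↦ Submodule.mem_sup_right h
  let e (i : Fin (finrank ℂ H)) : L := finBasis ℂ H i
  have he : Submodule.span ℂ (Set.range e) = H.toSubmodule := by
    have : Set.range e = H.toSubmodule.subtype '' Set.range (finBasis ℂ H) := by
      rw [← Set.range_comp]; rfl
    rw [this, ← Submodule.map_span, Basis.span_eq, Submodule.map_top, Submodule.range_subtype]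
  have hspan : Submodule.span ℂ (Set.range (Sum.elim e v)) = V := by
    rw [Set.Sum.elim_range, Submodule.span_union, he, Submodule.span_range_eq_iSup]
    conv_rhs => rw [hV.eq_iSup_inf_rootPlane hH (b := b), iSup_option]
    congr 1
    · exact (inf_eq_right.mpr hH).symm
    · exact iSup_congr fun α ↦ (hvV α).symm
  have hlimit := isLimitAtZero_of_tendsto (μ := C.oneParameterHom k)
    (linearIndependent_sumElim_rootPlane b hv hv0) hspan
    (linearIndependent_sumElim_rootPlane b huplane hu0) (Sum.elim (fun _ _ ↦ 1) c) <| by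
      rintro (i | α) f
      · refine tendsto_const_nhds.congr fun t ↦ ?_
        simp [C.oneParameterHom_apply_of_mem k t (finBasis ℂ H i).2]
      · exact hlim α f
  set W := Submodule.span ℂ (Set.range (Sum.elim e u)) with hW
  obtain ⟨hnull, hdim⟩ := IsNullspace.of_isLimitAtZero
    (fun t ↦ map_lie_of_mem_adjointGroup (C.torusHom_mem_adjointGroup _)) hV.1 hlimit
  have hmax : IsMaximalNullspace W := ⟨hnull, fun W' h ↦ hdim ▸ hV.2 W' h⟩
  have hHW : H.toSubmodule ≤ W := by
    rw [← he, hW, Set.Sum.elim_range, Submodule.span_union]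
    exact le_sup_left
  have huW (α : PosRoot b) : u α ∈ W := Submodule.subset_span ⟨Sum.inr α, rfl⟩
  obtain ⟨l⟩ := nonempty_coweight H
  have hstable : W.map (ad ℂ L l.elt) ≤ W := by
    rw [hW, Submodule.map_span_le]
    rintro _ ⟨i | α, rfl⟩
    · exact hHW (H.lie_mem l.elt.2 (finBasis ℂ H i).2)
    · rcases hu α with h | h
      · have := mem_gradedPiece.mp (l.rootSpace_le_gradedPiece _ h)
        exact (congr_arg (· ∈ W) this).mpr (W.smul_mem _ (huW α))
      · have := mem_gradedPiece.mp (l.rootSpace_le_gradedPiece (-α.1.1) (by simpa using h))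
        exact (congr_arg (· ∈ W) this).mpr (W.smul_mem _ (huW α))
  -- Closure under brackets: nullity puts `[x, y]` in `W^⊥`, which equals `ad l (W)` by maximality
  -- and lies in `W` because `W` is spanned by `H` and root vectors.
  let B : LieSubalgebra ℂ L :=
    { W with
      lie_mem' := fun {x y} hx hy ↦ hstable <| by
        rw [hmax.orthogonal_eq hHW l]
        intro z hz
        change killingForm ℂ L z ⁅x, y⁆ = 0
        rw [traceForm_comm]
        exact hnull x hx y hy z hz }
  refine ⟨B, hlimit, isBorelSubalgebra_of_isNullspace (H := H) hnull hHW fun χ hχ ↦ ?_⟩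
  have hle {ψ : Weight ℂ H L} (hψ : ψ.IsNonZero) {α : PosRoot b} (h : u α ∈ rootSpace H ψ) :
      (rootSpace H ψ).toSubmodule ≤ B.toSubmodule := fun x hx ↦ by
    obtain ⟨c, rfl⟩ := mem_span_of_mem_rootSpace hψ h (hu0 α) hx
    exact W.smul_mem c (huW α)
  obtain ⟨α, rfl | rfl⟩ := exists_posRoot b hχ
  · exact (hu α).imp (hle hχ) (hle (ψ := -α.1.1) (by simpa using hχ.neg))
  · exact (hu α).symm.imp (hle hχ) fun h ↦ by simpa using hle (PosRoot.isNonZero b α) h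

end NullSpaces

/-! ### The theorem, with the Engel subalgebra of a regular element of `V` as Cartan subalgebra. -/

theorem corollary4 {L : Type*} [LieRing L] [LieAlgebra ℂ L] [FiniteDimensional ℂ L]
    [LieAlgebra.IsSemisimple ℂ L] (V : Submodule ℂ L) (hV : NullSpaces.IsMaximalNullspace V) :
    (∃ s ∈ V, NullSpaces.IsRegularSemisimple s) ∧
    (∃ H : LieSubalgebra ℂ L, H.IsCartanSubalgebra ∧ H.toSubmodule ≤ V) ∧
    (∃ (T : Subgroup (L ≃ₗ[ℂ] L)) (μ : ℂˣ →* (L ≃ₗ[ℂ] L)) (B : LieSubalgebra ℂ L),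
      NullSpaces.IsMaximalTorus T ∧ NullSpaces.IsRegularOneParameterSubgroup T μ ∧
      NullSpaces.IsLimitAtZero μ V B.toSubmodule ∧ NullSpaces.IsBorelSubalgebra B) ∧
    (Module.finrank ℂ V : ℚ) = (Module.finrank ℂ L + LieAlgebra.rank ℂ L : ℚ) / 2 ∧
    (∀ (H : LieSubalgebra ℂ L) [H.IsCartanSubalgebra], H.toSubmodule ≤ V →
      ∀ b : (LieAlgebra.IsKilling.rootSystem H).Base, NullSpaces.IsCartanPlusLines V H b) := by
  obtain ⟨hdim, s, hsV, hs⟩ := hV.two_mul_finrank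
  have hcartan := NullSpaces.isCartanSubalgebra_engel_of_isRegular hs
  have hle := hV.engel_le hsV hs
  refine ⟨⟨s, hsV, NullSpaces.isRegularSemisimple_of_isRegular hs⟩, ⟨_, hcartan, hle⟩, ?_, ?_,
    fun H _ hH b ↦ hV.isCartanPlusLines hH⟩
  · obtain ⟨C⟩ := NullSpaces.nonempty_weightCoordinates (LieSubalgebra.engel ℂ s)
    obtain ⟨k, hk⟩ := C.exists_degree
    obtain ⟨B, hB, hB'⟩ := hV.exists_isLimitAtZero hle hk
    exact ⟨C.torus, C.oneParameterHom k, B, C.isMaximalTorus,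
      NullSpaces.WeightCoordinates.isRegularOneParameterSubgroup hk, hB, hB'⟩
  · have : (2 : ℚ) * Module.finrank ℂ V = Module.finrank ℂ L + LieAlgebra.rank ℂ L := by
      exact_mod_cast hdim
    linarith
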